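/- Let $K$ be a field of characteristic $0$, let $N\in\mathbb N_{\ge 2}\cup\{\omega\}$, and let $X$ be a set. Let $A=K\{X\}_N$ be the unitary free $\mathrm{Mag}_N$-algebra on $X$: the vector space with basis the empty tree $1$ and all planar rooted trees with leaves labelled by $X$ whose inner vertices have arity $\ge 2$ (and $\le N$ if $N\neq\omega$), with the multilinear operations $\vee^k$ ($2\le k\le N$, or all $k\ge 2$ if $N=\omega$) given by grafting $k$ trees onto a new root, where arguments equal to $1$ are omitted: $\vee^k(\ldots,1,\ldots)=\vee^{k-1}(\ldots,\ldots)$, $\vee^2(1,a)=\vee^2(a,1)=a$. Let $A^{(n)}$ be the span of the trees with $n$ leaves. Let $\Delta_a:A\to A\otimes A$ be the linear map with $\Delta_a(1)=1\otimes 1$, $\Delta_a(x)=x\otimes 1+1\otimes x$ for $x\in X$, which is a morphism for the operations $\vee^k$, where $\vee^k$ acts component-wise on $A\otimes A$. Let $\langle\cdot,\cdot\rangle$ be the bilinear form on $A$ for which the trees (including the empty one) are orthonormal, and let $\mathbin{\sqcup\!\sqcup}$ be the planar shuffle product on $A$, the dual of $\Delta_a$: $\langle f\mathbin{\sqcup\!\sqcup}g,h\rangle=\langle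 f\otimes g,\Delta_a(h)\rangle$ for all $f,g,h\in A$; with it $A$ is a commutative associative algebra with unit $1$. Let $W=\mathrm{Prim}\,A=\{f\in A:\Delta_a(f)=f\otimes 1+1\otimes f\}$ and $\mathrm{Prim}\,A^{(k)}=W\cap A^{(k)}$. Then $W=\bigoplus_{k}\mathrm{Prim}\,A^{(k)}$, and: (i) The commutative unital algebra $(A,\mathbin{\sqcup\!\sqcup})$ is freely generated by the vector space $W$, i.e. the canonical algebra homomorphism from the symmetric algebra of $W$ to $(A,\mathbin{\sqcup\!\sqcup})$ is an isomorphism. (ii) Let $n\ge 2$, and let $B^{(n)}=\{g\in A^{(n)}:\langle f,g\rangle=0\text{ for all }f\in\mathrm{Prim}\,A^{(n)}\}$ be the orthogonal complement of $\mathrm{Prim}\,A^{(n)}$ in $A^{(n)}$. If $(f_i)_{i\in I}$, with $I$ a linearly ordered set, is a basis of $\bigoplus_{k=1}^{n-1}\mathrm{Prim}\,A^{(k)}$ consisting of homogeneous elements, then the elements $$f_{i_1}\mathbin{\sqcup\!\sqcup}f_{i_2}\mathbin{\sqcup\!\sqcup}\cdots\mathbin{\sqcup\!\sqcup}f_{i_k},\qquad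 k\ge 1,\quad i_1\le i_2\le\cdots\le i_k,\quad \sum_{j=1}^k\deg f_{i_j}=n,$$ form a basis of $B^{(n)}$ (distinct index sequences giving distinct basis elements). -/

import Mathlib

open scoped TensorProduct

noncomputable section

/-- Non-empty planar reduced rooted trees all of whose inner vertices have arity at most `N`
(`N = ⊤` is the case `N = ω`: no bound on the arities), with leaves labelled by `X`.
`node k h2 hN c` is the grafting `∨^k(c 0, …, c (k-1))` of `k ≥ 2` trees over a new root. -/
inductive MagTree (N : ℕ∞) (X : Type*) where
  | leaf (x : X) : MagTree N X
  | node (k : ℕ) (h2 : 2 ≤ k) (hN : (k : ℕ∞) ≤ N) (c : Fin k → MagTree N X) : MagTree N X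

namespace MagTree

variable {N : ℕ∞} {X : Type*}

/-- The multiset of the labels of the leaves of a tree. -/
def labels : MagTree N X → Multiset X
  | leaf x => {x}
  | node _ _ _ c => ∑ i, labels (c i)

/-- The degree of a tree: its number of leaves. -/
def degree (T : MagTree N X) : ℕ := Multiset.card T.labels

end MagTree

/-- The unitary free `Mag_N`-algebra `A = K{X}_N`: the vector space with basis the empty tree
(`none`, the unit `1`) and the trees of `MagTree N X`. Its operations `∨^k` are `FreeMag.vee`. -/
def FreeMag (K : Type*) (N : ℕ∞) (X : Type*) [Field K] : Type _ := Option (MagTree N X) →₀ K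

namespace FreeMag

variable (K : Type*) [Field K] (N : ℕ∞) (X : Type*)

instance : AddCommGroup (FreeMag K N X) := inferInstanceAs (AddCommGroup (_ →₀ K))
instance : Module K (FreeMag K N X) := inferInstanceAs (Module K (_ →₀ K))

/-- The basis of `K{X}_N` consisting of the empty tree and the trees. -/
def treeBasis : Module.Basis (Option (MagTree N X)) K (FreeMag K N X) :=
  Module.Basis.ofRepr (LinearEquiv.refl K _)

/-- The unit of `K{X}_N` is the empty tree. -/
instance : One (FreeMag K N X) := ⟨treeBasis K N X none⟩

variable {K N X} in
/-- A tree as an element of `K{X}_N`. -/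
def ofTree (T : MagTree N X) : FreeMag K N X := treeBasis K N X (some T)

/-- The variable `x` as an element of `K{X}_N`. -/
def var (x : X) : FreeMag K N X := ofTree (.leaf x)

/-- The bilinear form `⟨·,·⟩` on `K{X}_N` for which the trees are orthonormal. -/
def pairing : FreeMag K N X →ₗ[K] FreeMag K N X →ₗ[K] K :=
  (treeBasis K N X).constr K (treeBasis K N X).coord

/-! ### The operations `∨^k`

A planar forest is a word of non-empty trees. The space of forests is an associative algebra
under concatenation, with the empty forest as unit. The operation `∨^k` on `k` (possibly empty)
trees concatenates them to a forest, the empty trees disappearing, and then grafts this forest;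
the grafting of the empty forest is `1` and the grafting of a single tree is that tree.
This is the unit action `∨^k(…, 1, …) = ∨^{k-1}(…, …)`, `∨^2(1, a) = ∨^2(a, 1) = a`. -/

/-- The concatenation algebra of planar forests. -/
abbrev Forests := MonoidAlgebra K (FreeMonoid (MagTree N X))

/-- A tree as a forest; the empty tree is the empty forest. -/
def toForest : FreeMag K N X →ₗ[K] Forests K N X :=
  (treeBasis K N X).constr K fun
    | none => 1
    | some T => MonoidAlgebra.of K _ (FreeMonoid.of T)

variable {N X} in
/-- Grafting of a word of trees. (Words of more than `N ≥ 2` trees cannot be grafted in `K{X}_N`,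
the value `0` is a dummy that is never used in `∨^k`, `k ≤ N`.) -/
def graftWord : List (MagTree N X) → FreeMag K N X
  | [] => 1
  | [T] => ofTree T
  | S :: T :: l =>
    if h : ((S :: T :: l).length : ℕ∞) ≤ N then
      ofTree (.node (S :: T :: l).length (by simp) h (S :: T :: l).get)
    else 0

/-- Grafting of forests, linearly extended. -/
def graft : Forests K N X →ₗ[K] FreeMag K N X :=
  (MonoidAlgebra.basis (FreeMonoid (MagTree N X)) K).constr K fun w => graftWord K w.toList

variable {K} in
/-- The `k`-fold multiplication of an associative algebra `C`, transported to `M` along linear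
maps `e : M → C` and `g : C → M`. -/
def transportOp {M C : Type*} [AddCommGroup M] [Module K M] [Ring C] [Algebra K C]
    (e : M →ₗ[K] C) (g : C →ₗ[K] M) (k : ℕ) : MultilinearMap K (fun _ : Fin k => M) M :=
  g.compMultilinearMap ((MultilinearMap.mkPiAlgebraFin K k C).compLinearMap fun _ => e)

/-- The operation `∨^k` of `K{X}_N` (to be used for `k ≤ N`). -/
def vee (k : ℕ) : MultilinearMap K (fun _ : Fin k => FreeMag K N X) (FreeMag K N X) :=
  transportOp (toForest K N X) (graft K N X) k

/-- The operation `∨^k` of the unitary `Mag_N`-algebra `K{X}_N ⊗ K{X}_N` (for `k ≤ N`). It is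
the component-wise one, see `veeTensor_tmul`. -/
def veeTensor (k : ℕ) : MultilinearMap K (fun _ : Fin k => FreeMag K N X ⊗[K] FreeMag K N X)
    (FreeMag K N X ⊗[K] FreeMag K N X) :=
  transportOp (TensorProduct.map (toForest K N X) (toForest K N X))
    (TensorProduct.map (graft K N X) (graft K N X)) k

variable {N X} in
/-- The value of the co-addition on a tree. -/
def coaddTree : MagTree N X → FreeMag K N X ⊗[K] FreeMag K N X
  | .leaf x => var K N X x ⊗ₜ 1 + 1 ⊗ₜ var K N X x
  | .node k _ _ c => veeTensor K N X k fun i => coaddTree (c i)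

/-- The co-addition `Δ_a : A → A ⊗ A`, the morphism of unitary `Mag_N`-algebras with
`Δ_a(x) = x ⊗ 1 + 1 ⊗ x` for all variables `x`; see `coadd_one`, `coadd_var`, `coadd_vee`. -/
def coadd : FreeMag K N X →ₗ[K] FreeMag K N X ⊗[K] FreeMag K N X :=
  (treeBasis K N X).constr K fun
    | none => 1 ⊗ₜ 1
    | some T => coaddTree K T

/-! ### Basic properties of the operations and of the co-addition -/

section basic

variable {K N X}

lemma ofFn_tmul_prod {A B : Type*} [Ring A] [Algebra K A] [Ring B] [Algebra K B] {k : ℕ}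
    (x : Fin k → A) (y : Fin k → B) :
    (List.ofFn fun i => x i ⊗ₜ[K] y i).prod = (List.ofFn x).prod ⊗ₜ[K] (List.ofFn y).prod := by
  induction k with
  | zero => simp [Algebra.TensorProduct.one_def]
  | succ k ih => simp [List.ofFn_succ, ih]

lemma transportOp_apply {M C : Type*} [AddCommGroup M] [Module K M] [Ring C] [Algebra K C]
    (e : M →ₗ[K] C) (g : C →ₗ[K] M) (k : ℕ) (a : Fin k → M) :
    transportOp e g k a = g (List.ofFn fun i => e (a i)).prod := by
  simp [transportOp]

lemma transportOp_tmul {M C M' C' : Type*} [AddCommGroup M] [Module K M] [Ring C] [Algebra K C]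
    [AddCommGroup M'] [Module K M'] [Ring C'] [Algebra K C']
    (e : M →ₗ[K] C) (g : C →ₗ[K] M) (e' : M' →ₗ[K] C') (g' : C' →ₗ[K] M') (k : ℕ)
    (a : Fin k → M) (b : Fin k → M') :
    transportOp (TensorProduct.map e e') (TensorProduct.map g g') k (fun i => a i ⊗ₜ b i) =
      transportOp e g k a ⊗ₜ transportOp e' g' k b := by
  simp [transportOp_apply, ofFn_tmul_prod]

lemma multilinear_ext_tmul {M M' P : Type*} [AddCommGroup M] [Module K M]
    [AddCommGroup M'] [Module K M'] [AddCommGroup P] [Module K P] {k : ℕ}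
    {f g : MultilinearMap K (fun _ : Fin k => M ⊗[K] M') P}
    (h : ∀ (a : Fin k → M) (b : Fin k → M'), f (fun i => a i ⊗ₜ b i) = g (fun i => a i ⊗ₜ b i)) :
    f = g :=
  Module.Basis.ext_multilinear
    (fun _ => (Module.Basis.ofVectorSpace K M).tensorProduct (Module.Basis.ofVectorSpace K M'))
    fun v => by
      simpa only [Module.Basis.tensorProduct_apply'] using h (fun i => Module.Basis.ofVectorSpace K M (v i).1)
        (fun i => Module.Basis.ofVectorSpace K M' (v i).2)

lemma veeTensor_tmul (k : ℕ) (a b : Fin k → FreeMag K N X) :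
    veeTensor K N X k (fun i => a i ⊗ₜ b i) = vee K N X k a ⊗ₜ vee K N X k b :=
  transportOp_tmul _ _ _ _ k a b

lemma toForest_one : toForest K N X 1 = 1 := (treeBasis K N X).constr_basis K _ none

lemma toForest_ofTree (T : MagTree N X) :
    toForest K N X (ofTree T) = MonoidAlgebra.of K _ (FreeMonoid.of T) :=
  (treeBasis K N X).constr_basis K _ (some T)

lemma graft_of (w : FreeMonoid (MagTree N X)) :
    graft K N X (MonoidAlgebra.of K _ w) = graftWord K w.toList := by
  have := (MonoidAlgebra.basis (FreeMonoid (MagTree N X)) K).constr_basis K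
    (fun w => graftWord K w.toList) w
  simpa [graft] using this

lemma graft_one : graft K N X 1 = 1 := by
  rw [← map_one (MonoidAlgebra.of K (FreeMonoid (MagTree N X))), graft_of]; rfl

lemma graft_toForest (f : FreeMag K N X) : graft K N X (toForest K N X f) = f := by
  have : graft K N X ∘ₗ toForest K N X = LinearMap.id := (treeBasis K N X).ext fun i => by
    rcases i with _ | T
    · exact (congrArg (graft K N X) toForest_one).trans graft_one
    · refine (congrArg (graft K N X) (toForest_ofTree T)).trans ?_
      rw [graft_of]; rfl
  exact LinearMap.congr_fun this f

lemma coadd_one : coadd K N X 1 = 1 ⊗ₜ 1 := (treeBasis K N X).constr_basis K _ none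

lemma coadd_ofTree (T : MagTree N X) : coadd K N X (ofTree T) = coaddTree K T :=
  (treeBasis K N X).constr_basis K _ (some T)

lemma coadd_var (x : X) : coadd K N X (var K N X x) = var K N X x ⊗ₜ 1 + 1 ⊗ₜ var K N X x :=
  coadd_ofTree _

lemma prod_of (l : List (MagTree N X)) :
    (l.map fun T => MonoidAlgebra.of K _ (FreeMonoid.of T)).prod =
      MonoidAlgebra.of K _ (FreeMonoid.ofList l) := by
  induction l with
  | nil => exact (map_one (MonoidAlgebra.of K (FreeMonoid (MagTree N X)))).symm
  | cons T l ih => rw [List.map_cons, List.prod_cons, ih, ← map_mul]; rfl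

lemma graftWord_eq (l : List (MagTree N X)) (h2 : 2 ≤ l.length) (hN : (l.length : ℕ∞) ≤ N) :
    graftWord K l = ofTree (.node l.length h2 hN l.get) := by
  match l with
  | S :: T :: l => simp only [graftWord, dif_pos hN]

lemma node_ofFn (k : ℕ) (h2 : 2 ≤ k) (hN : (k : ℕ∞) ≤ N) (c : Fin k → MagTree N X) (h2' hN') :
    MagTree.node (List.ofFn c).length h2' hN' (List.ofFn c).get = .node k h2 hN c := by
  have : ∀ (m : ℕ) (hm : m = k) (h2' : 2 ≤ m) (hN' : (m : ℕ∞) ≤ N) (d : Fin m → MagTree N X),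
      (∀ i, d i = c (Fin.cast hm i)) → MagTree.node m h2' hN' d = .node k h2 hN c := by
    rintro m rfl _ _ d hd
    congr 1
    exact funext hd
  exact this _ (by simp) _ _ _ fun i => by simp only [List.get_ofFn]

lemma vee_ofTree (k : ℕ) (h2 : 2 ≤ k) (hN : (k : ℕ∞) ≤ N) (c : Fin k → MagTree N X) :
    vee K N X k (fun i => ofTree (c i)) = ofTree (.node k h2 hN c) := by
  have h1 : (List.ofFn fun i => toForest K N X (ofTree (c i))).prod =
      MonoidAlgebra.of K _ (FreeMonoid.ofList (List.ofFn c)) := by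
    rw [← prod_of, List.map_ofFn]
    simp only [toForest_ofTree, Function.comp_def]
  rw [vee, transportOp_apply, h1, graft_of]
  exact (graftWord_eq (List.ofFn c) (by simpa using h2) (by simpa using hN)).trans
    (congrArg ofTree (node_ofFn k h2 hN c _ _))

variable (K N X) in
/-- The multiplicative extension of the co-addition to forests. -/
def forestCoadd : Forests K N X →ₐ[K] Forests K N X ⊗[K] Forests K N X :=
  MonoidAlgebra.lift K _ (FreeMonoid (MagTree N X)) (FreeMonoid.lift fun T =>
    TensorProduct.map (toForest K N X) (toForest K N X) (coaddTree K T))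

lemma forestCoadd_of (w : FreeMonoid (MagTree N X)) :
    forestCoadd K N X (MonoidAlgebra.of K _ w) = (w.toList.map fun T =>
      TensorProduct.map (toForest K N X) (toForest K N X) (coaddTree K T)).prod := by
  rw [forestCoadd, MonoidAlgebra.lift_of, FreeMonoid.lift_apply]

lemma forestCoadd_toForest (f : FreeMag K N X) :
    forestCoadd K N X (toForest K N X f) =
      TensorProduct.map (toForest K N X) (toForest K N X) (coadd K N X f) := by
  have : (forestCoadd K N X).toLinearMap ∘ₗ toForest K N X =
      TensorProduct.map (toForest K N X) (toForest K N X) ∘ₗ coadd K N X :=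
    (treeBasis K N X).ext fun i => by
      rcases i with _ | T
      · change forestCoadd K N X (toForest K N X 1) =
          TensorProduct.map (toForest K N X) (toForest K N X) (coadd K N X 1)
        simp [toForest_one, coadd_one, Algebra.TensorProduct.one_def]
      · change forestCoadd K N X (toForest K N X (ofTree T)) =
          TensorProduct.map (toForest K N X) (toForest K N X) (coadd K N X (ofTree T))
        rw [toForest_ofTree, coadd_ofTree, forestCoadd_of]
        simp
  exact LinearMap.congr_fun this f

lemma map_graft_toForest (t : FreeMag K N X ⊗[K] FreeMag K N X) :
    TensorProduct.map (graft K N X) (graft K N X)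
      (TensorProduct.map (toForest K N X) (toForest K N X) t) = t := by
  induction t with
  | zero => simp
  | tmul a b => simp [graft_toForest]
  | add a b ha hb => rw [map_add, map_add, ha, hb]

lemma coadd_graftWord (l : List (MagTree N X)) (hl : (l.length : ℕ∞) ≤ N) :
    coadd K N X (graftWord K l) = TensorProduct.map (graft K N X) (graft K N X)
      (forestCoadd K N X (MonoidAlgebra.of K _ (FreeMonoid.ofList l))) := by
  rw [forestCoadd_of]
  match l with
  | [] =>
    change coadd K N X 1 = TensorProduct.map (graft K N X) (graft K N X) 1
    simp [coadd_one, Algebra.TensorProduct.one_def, graft_one]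
  | [T] =>
    change coadd K N X (ofTree T) = _
    simp [coadd_ofTree, map_graft_toForest]
  | S :: T :: l =>
    rw [graftWord_eq _ (by simp) hl, coadd_ofTree, coaddTree, veeTensor, transportOp_apply]
    congr 2
    exact (List.map_ofFn (f := (S :: T :: l).get) (g := fun T => TensorProduct.map
      (toForest K N X) (toForest K N X) (coaddTree K T))).symm.trans (by rw [List.ofFn_get]; rfl)

lemma toForest_basis (o : Option (MagTree N X)) :
    toForest K N X (treeBasis K N X o) =
      (o.toList.map fun T => MonoidAlgebra.of K _ (FreeMonoid.of T)).prod := by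
  rcases o with _ | T
  · exact toForest_one
  · exact (toForest_ofTree T).trans (by simp)

lemma prod_toForest_basis {k : ℕ} (c : Fin k → Option (MagTree N X)) :
    (List.ofFn fun i => toForest K N X (treeBasis K N X (c i))).prod =
      MonoidAlgebra.of K _ (FreeMonoid.ofList ((List.ofFn c).flatMap Option.toList)) := by
  rw [← prod_of]
  induction k with
  | zero => simp
  | succ k ih =>
    rw [List.ofFn_succ, List.prod_cons, ih fun i => c i.succ, toForest_basis, List.ofFn_succ,
      List.flatMap_cons, List.map_append, List.prod_append]

lemma length_flatMap_toList_le {T : Type*} (l : List (Option T)) :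
    (l.flatMap Option.toList).length ≤ l.length := by
  induction l with
  | nil => simp
  | cons o l ih =>
    rw [List.flatMap_cons, List.length_append, List.length_cons]
    have : o.toList.length ≤ 1 := by rcases o with _ | T <;> simp
    omega

/-- `Δ_a` is a morphism of unitary `Mag_N`-algebras. -/
lemma coadd_vee (k : ℕ) (hk : (k : ℕ∞) ≤ N) (f : Fin k → FreeMag K N X) :
    coadd K N X (vee K N X k f) = veeTensor K N X k fun i => coadd K N X (f i) := by
  have : (coadd K N X).compMultilinearMap (vee K N X k) =
      (veeTensor K N X k).compLinearMap fun _ => coadd K N X :=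
    Module.Basis.ext_multilinear (fun _ => treeBasis K N X) fun c => by
      have hl : (((List.ofFn c).flatMap Option.toList).length : ℕ∞) ≤ N :=
        le_trans (by exact_mod_cast (length_flatMap_toList_le _).trans (by simp)) hk
      simp only [LinearMap.compMultilinearMap_apply, MultilinearMap.compLinearMap_apply,
        vee, veeTensor, transportOp_apply]
      rw [prod_toForest_basis, graft_of]
      refine (coadd_graftWord _ hl).trans ?_
      rw [← prod_toForest_basis, map_list_prod, List.map_ofFn]
      simp only [Function.comp_def, forestCoadd_toForest]
  exact DFunLike.congr_fun this f

lemma tree_ext {P : Type*} [AddCommGroup P] [Module K P] {F G : FreeMag K N X →ₗ[K] P}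
    (h1 : F 1 = G 1) (hT : ∀ T, F (ofTree T) = G (ofTree T)) : F = G :=
  (treeBasis K N X).ext fun i => by
    rcases i with _ | T
    exacts [h1, hT T]

lemma coadd_node (k : ℕ) (h2 hN) (c : Fin k → MagTree N X) :
    coadd K N X (ofTree (.node k h2 hN c)) =
      veeTensor K N X k fun i => coadd K N X (ofTree (c i)) := by
  simp only [coadd_ofTree, coaddTree]

lemma comm_veeTensor (k : ℕ) (t : Fin k → FreeMag K N X ⊗[K] FreeMag K N X) :
    TensorProduct.comm K _ _ (veeTensor K N X k t) =
      veeTensor K N X k fun i => TensorProduct.comm K _ _ (t i) := by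
  have : (TensorProduct.comm K _ _).toLinearMap.compMultilinearMap (veeTensor K N X k) =
      (veeTensor K N X k).compLinearMap fun _ => (TensorProduct.comm K _ _).toLinearMap :=
    multilinear_ext_tmul fun a b => by simp [veeTensor_tmul]
  exact DFunLike.congr_fun this t

lemma comm_coadd (f : FreeMag K N X) :
    TensorProduct.comm K _ _ (coadd K N X f) = coadd K N X f := by
  have : (TensorProduct.comm K _ _).toLinearMap ∘ₗ coadd K N X = coadd K N X := by
    refine tree_ext (by simp [coadd_one]) fun T => ?_
    induction T with
    | leaf x =>
      change TensorProduct.comm K _ _ (coadd K N X (var K N X x)) = coadd K N X (var K N X x)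
      simp [coadd_var, add_comm]
    | node k h2 hN c ih =>
      simp only [LinearMap.comp_apply, LinearEquiv.coe_coe] at ih ⊢
      simp only [coadd_node, comm_veeTensor, ih]
  exact LinearMap.congr_fun this f

variable (K N X) in
/-- The augmentation: the coefficient of the empty tree. -/
def augmentation : FreeMag K N X →ₗ[K] K := (treeBasis K N X).coord none

lemma augmentation_one : augmentation K N X 1 = 1 := by
  change (treeBasis K N X).coord none (treeBasis K N X none) = 1
  simp

lemma augmentation_ofTree (T : MagTree N X) : augmentation K N X (ofTree T) = 0 := by
  change (treeBasis K N X).coord none (treeBasis K N X (some T)) = 0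
  simp

lemma augmentation_graftWord (l : List (MagTree N X)) :
    augmentation K N X (graftWord K l) = if l = [] then 1 else 0 := by
  match l with
  | [] => exact augmentation_one
  | [T] => exact (augmentation_ofTree T).trans (by simp)
  | S :: T :: l =>
    rw [graftWord]
    split_ifs <;> simp_all [augmentation_ofTree]

lemma augmentation_vee (k : ℕ) (f : Fin k → FreeMag K N X) :
    augmentation K N X (vee K N X k f) = ∏ i, augmentation K N X (f i) := by
  have : (augmentation K N X).compMultilinearMap (vee K N X k) =
      (MultilinearMap.mkPiAlgebra K (Fin k) K).compLinearMap fun _ => augmentation K N X :=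
    Module.Basis.ext_multilinear (fun _ => treeBasis K N X) fun c => by
      simp only [LinearMap.compMultilinearMap_apply, MultilinearMap.compLinearMap_apply,
        vee, transportOp_apply, MultilinearMap.mkPiAlgebra_apply]
      rw [prod_toForest_basis, graft_of]
      refine (augmentation_graftWord _).trans ?_
      by_cases h : ∀ i, c i = none
      · rw [if_pos, Finset.prod_eq_one]
        · intro i _
          rw [h i]; exact augmentation_one
        · change (List.ofFn c).flatMap Option.toList = []
          simp [List.flatMap_eq_nil_iff, h]
      · push Not at h
        obtain ⟨i, hi⟩ := h
        obtain ⟨T, hT⟩ := Option.ne_none_iff_exists'.1 hi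
        rw [if_neg, Finset.prod_eq_zero (Finset.mem_univ i)]
        · rw [hT]; exact augmentation_ofTree T
        · intro h0
          have := List.flatMap_eq_nil_iff.1 h0 (c i) (by simp [List.mem_ofFn])
          simp [hT] at this
  simpa using DFunLike.congr_fun this f

lemma lid_rTensor_veeTensor (k : ℕ) (t : Fin k → FreeMag K N X ⊗[K] FreeMag K N X) :
    TensorProduct.lid K _ ((augmentation K N X).rTensor _ (veeTensor K N X k t)) =
      vee K N X k fun i => TensorProduct.lid K _ ((augmentation K N X).rTensor _ (t i)) := by
  have : ((TensorProduct.lid K _).toLinearMap ∘ₗ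
        (augmentation K N X).rTensor _).compMultilinearMap (veeTensor K N X k) =
      (vee K N X k).compLinearMap fun _ => ((TensorProduct.lid K _).toLinearMap ∘ₗ
        (augmentation K N X).rTensor _) :=
    multilinear_ext_tmul fun a b => by
      simp [veeTensor_tmul, augmentation_vee, MultilinearMap.map_smul_univ]
  exact DFunLike.congr_fun this t

lemma lid_rTensor_coadd (f : FreeMag K N X) :
    TensorProduct.lid K _ ((augmentation K N X).rTensor _ (coadd K N X f)) = f := by
  have : (TensorProduct.lid K _).toLinearMap ∘ₗ
      (augmentation K N X).rTensor _ ∘ₗ coadd K N X = LinearMap.id := by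
    refine tree_ext (by simp [coadd_one, augmentation_one]) fun T => ?_
    induction T with
    | leaf x =>
      change TensorProduct.lid K _ ((augmentation K N X).rTensor _
        (coadd K N X (var K N X x))) = var K N X x
      simp only [coadd_var, map_add, LinearMap.rTensor_tmul, augmentation_one,
        TensorProduct.lid_tmul, one_smul]
      simp [var, augmentation_ofTree]
    | node k h2 hN c ih =>
      simp only [LinearMap.comp_apply, LinearEquiv.coe_coe, LinearMap.id_apply] at ih ⊢
      simp only [coadd_node, lid_rTensor_veeTensor, ih, vee_ofTree k h2 hN]
  exact LinearMap.congr_fun this f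

/-- `Δ_a` is coassociative. -/
lemma coadd_coassoc (f : FreeMag K N X) :
    TensorProduct.assoc K _ _ _ ((coadd K N X).rTensor _ (coadd K N X f)) =
      (coadd K N X).lTensor _ (coadd K N X f) := by
  have : (TensorProduct.assoc K _ _ _).toLinearMap ∘ₗ (coadd K N X).rTensor _ ∘ₗ coadd K N X =
      (coadd K N X).lTensor _ ∘ₗ coadd K N X := by
    refine tree_ext (by simp [coadd_one]) fun T => ?_
    induction T with
    | leaf x =>
      change TensorProduct.assoc K _ _ _ ((coadd K N X).rTensor _
        (coadd K N X (var K N X x))) = (coadd K N X).lTensor _ (coadd K N X (var K N X x))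
      simp [coadd_var, coadd_one, TensorProduct.add_tmul, TensorProduct.tmul_add, add_assoc]
    | node k h2 hN c ih =>
      let e := toForest K N X
      let g := graft K N X
      let op := transportOp (K := K) (M := FreeMag K N X ⊗[K] (FreeMag K N X ⊗[K] FreeMag K N X))
        (C := Forests K N X ⊗[K] (Forests K N X ⊗[K] Forests K N X))
        (TensorProduct.map e (TensorProduct.map e e)) (TensorProduct.map g (TensorProduct.map g g)) k
      let op' := transportOp (K := K) (M := (FreeMag K N X ⊗[K] FreeMag K N X) ⊗[K] FreeMag K N X)
        (C := (Forests K N X ⊗[K] Forests K N X) ⊗[K] Forests K N X)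
        (TensorProduct.map (TensorProduct.map e e) e) (TensorProduct.map (TensorProduct.map g g) g) k
      have h1 : ((coadd K N X).lTensor _).compMultilinearMap (veeTensor K N X k) =
          op.compLinearMap fun _ => (coadd K N X).lTensor _ :=
        multilinear_ext_tmul fun a b => by
          simp only [LinearMap.compMultilinearMap_apply, MultilinearMap.compLinearMap_apply,
            veeTensor_tmul, LinearMap.lTensor_tmul, coadd_vee k hN, op]
          exact (transportOp_tmul _ _ _ _ k _ _).symm
      have h2 : ((coadd K N X).rTensor _).compMultilinearMap (veeTensor K N X k) =
          op'.compLinearMap fun _ => (coadd K N X).rTensor _ :=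
        multilinear_ext_tmul fun a b => by
          simp only [LinearMap.compMultilinearMap_apply, MultilinearMap.compLinearMap_apply,
            veeTensor_tmul, LinearMap.rTensor_tmul, coadd_vee k hN, op']
          exact (transportOp_tmul _ _ _ _ k _ _).symm
      have h3 : ∀ t, TensorProduct.assoc K _ _ _ (op' t) =
          op fun i => TensorProduct.assoc K _ _ _ (t i) := by
        intro t
        have hg : ∀ s, TensorProduct.assoc K _ _ _
            (TensorProduct.map (TensorProduct.map g g) g s) =
            TensorProduct.map g (TensorProduct.map g g)
              (Algebra.TensorProduct.assoc K K K _ _ _ s) :=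
          fun s => (TensorProduct.map_map_assoc _ _ _ s).symm
        have he : ∀ s, TensorProduct.map e (TensorProduct.map e e)
            (TensorProduct.assoc K _ _ _ s) = Algebra.TensorProduct.assoc K K K _ _ _
            (TensorProduct.map (TensorProduct.map e e) e s) :=
          fun s => TensorProduct.map_map_assoc _ _ _ s
        simp only [op, op', transportOp_apply, hg, he, map_list_prod, List.map_ofFn,
          Function.comp_def]
      have h1' := fun t => DFunLike.congr_fun h1 t
      have h2' := fun t => DFunLike.congr_fun h2 t
      simp only [LinearMap.compMultilinearMap_apply, MultilinearMap.compLinearMap_apply] at h1' h2'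
      simp only [LinearMap.comp_apply, LinearEquiv.coe_coe] at ih ⊢
      simp only [coadd_node, h1', h2', h3, ih]
  exact LinearMap.congr_fun this f

/-! ### The shuffle product -/

variable (K N X) in
/-- `(K{X}_N, Δ_a)` is a coalgebra. -/
instance : Coalgebra K (FreeMag K N X) where
  comul := coadd K N X
  counit := augmentation K N X
  coassoc := LinearMap.ext coadd_coassoc
  rTensor_counit_comp_comul := LinearMap.ext fun f => by
    apply (TensorProduct.lid K _).injective
    simpa using lid_rTensor_coadd f
  lTensor_counit_comp_comul := LinearMap.ext fun f => by
    apply (TensorProduct.rid K _).injective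
    have h : ∀ t : FreeMag K N X ⊗[K] FreeMag K N X,
        TensorProduct.rid K _ ((augmentation K N X).lTensor _ t) =
        TensorProduct.lid K _ ((augmentation K N X).rTensor _ (TensorProduct.comm K _ _ t)) := by
      intro t
      induction t with
      | zero => simp
      | tmul a b => simp
      | add a b ha hb => simp only [map_add, ha, hb]
    simpa [comm_coadd, lid_rTensor_coadd] using h (coadd K N X f)

instance : Coalgebra.IsCocomm K (FreeMag K N X) where
  comm_comp_comul := LinearMap.ext comm_coadd

lemma finite_card_le (F : Finset X) (n : ℕ) :
    {T : MagTree N X | T.degree ≤ n ∧ ∀ x ∈ T.labels, x ∈ F}.Finite := by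
  have hpos : ∀ T : MagTree N X, 1 ≤ T.degree := by
    intro T
    induction T with
    | leaf x => simp [MagTree.degree, MagTree.labels]
    | node k h2 hN c ih =>
      simp only [MagTree.degree, MagTree.labels] at ih ⊢
      refine le_of_le_of_eq ?_ (map_sum Multiset.cardHom (fun i => (c i).labels) Finset.univ).symm
      exact (ih ⟨0, by omega⟩).trans
        (Finset.single_le_sum (f := fun i => Multiset.card (c i).labels)
          (fun i _ => Nat.zero_le _) (Finset.mem_univ (⟨0, by omega⟩ : Fin k)))
  induction n with
  | zero =>
    refine Set.Finite.subset Set.finite_empty fun T hT => ?_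
    have h1 := hpos T
    have h2 := hT.1
    omega
  | succ n ih =>
    have hfin : ((MagTree.leaf '' (F : Set X) : Set (MagTree N X)) ∪
        ⋃ k ∈ Finset.range (n + 2), ⋃ (h2 : 2 ≤ k), ⋃ (hN : (k : ℕ∞) ≤ N),
          MagTree.node k h2 hN '' Set.univ.pi fun _ =>
            {T : MagTree N X | T.degree ≤ n ∧ ∀ x ∈ T.labels, x ∈ F}).Finite := by
      refine (F.finite_toSet.image _).union (Set.Finite.biUnion (Finset.finite_toSet _) ?_)
      exact fun k _ => Set.finite_iUnion fun _ => Set.finite_iUnion fun _ =>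
        (Set.Finite.pi fun _ => ih).image _
    refine hfin.subset fun T hT => ?_
    rcases T with x | ⟨k, h2, hN, c⟩
    · exact Or.inl ⟨x, by simpa [MagTree.labels] using hT.2, rfl⟩
    · have hdeg : ∑ i, (c i).degree ≤ n + 1 := by
        have := hT.1
        simpa [MagTree.degree, MagTree.labels] using this
      have hk : k ≤ ∑ i, (c i).degree := by
        simpa using Finset.sum_le_sum fun i (_ : i ∈ Finset.univ) => hpos (c i)
      refine Or.inr ?_
      simp only [Set.mem_iUnion]
      refine ⟨k, by simp; omega, h2, hN, c, fun i _ => ⟨?_, fun x hx => hT.2 x ?_⟩, rfl⟩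
      · have : Nontrivial (Fin k) := Fin.nontrivial_iff_two_le.2 h2
        obtain ⟨j, hj⟩ := exists_ne i
        have h3 : (c i).degree + (c j).degree ≤ ∑ i, (c i).degree := by
          rw [← Finset.sum_pair (f := fun i => (c i).degree) hj.symm]
          exact Finset.sum_le_sum_of_subset (Finset.subset_univ _)
        have := hpos (c j)
        omega
      · simp only [MagTree.labels, Multiset.mem_sum]
        exact ⟨i, Finset.mem_univ _, hx⟩

lemma finite_labels_eq (α : Multiset X) : {T : MagTree N X | T.labels = α}.Finite := by
  classical
  refine (finite_card_le α.toFinset (Multiset.card α)).subset ?_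
  rintro T rfl
  exact ⟨le_rfl, by simp⟩

/-- The labels of the leaves of a possibly empty tree. -/
def optLabels (o : Option (MagTree N X)) : Multiset X := o.elim 0 MagTree.labels

/-- The labels of the leaves of a forest. -/
def forestLabels (w : FreeMonoid (MagTree N X)) : Multiset X :=
  (w.toList.map MagTree.labels).sum

lemma finite_optLabels_eq (α : Multiset X) :
    {o : Option (MagTree N X) | optLabels o = α}.Finite := by
  refine ((Set.finite_singleton none).union ((finite_labels_eq (N := N) α).image some)).subset ?_
  rintro (_ | T) hT
  · exact Or.inl rfl
  · exact Or.inr ⟨T, hT, rfl⟩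

variable (K N X) in
/-- The part of `A ⊗ A` of total label content `α`. -/
def contentTensor (α : Multiset X) : Submodule K (FreeMag K N X ⊗[K] FreeMag K N X) :=
  Submodule.span K {t | ∃ S T, optLabels S + optLabels T = α ∧
    treeBasis K N X S ⊗ₜ treeBasis K N X T = t}

variable (K N X) in
/-- The part of total label content `α` of the tensor square of the space of forests. -/
def contentForest (α : Multiset X) : Submodule K (Forests K N X ⊗[K] Forests K N X) :=
  Submodule.span K {t | ∃ v w, forestLabels v + forestLabels w = α ∧
    MonoidAlgebra.of K _ v ⊗ₜ MonoidAlgebra.of K _ w = t}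

lemma map_toForest_mem {α : Multiset X} {t : FreeMag K N X ⊗[K] FreeMag K N X}
    (ht : t ∈ contentTensor K N X α) :
    TensorProduct.map (toForest K N X) (toForest K N X) t ∈ contentForest K N X α := by
  refine (Submodule.span_le (p := (contentForest K N X α).comap _)).2 ?_ ht
  rintro _ ⟨S, T, h, rfl⟩
  refine Submodule.subset_span ⟨FreeMonoid.ofList S.toList, FreeMonoid.ofList T.toList, ?_, ?_⟩
  · rw [← h]
    rcases S with _ | S <;> rcases T with _ | T <;> simp [forestLabels, optLabels]
  · rw [TensorProduct.map_tmul, toForest_basis, toForest_basis, prod_of, prod_of]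

lemma graftWord_eq_basis (l : List (MagTree N X)) : graftWord K l = 0 ∨
    ∃ o, graftWord K l = treeBasis K N X o ∧ optLabels o = (l.map MagTree.labels).sum := by
  match l with
  | [] => exact Or.inr ⟨none, rfl, rfl⟩
  | [T] => exact Or.inr ⟨some T, rfl, by simp [optLabels]⟩
  | S :: T :: l =>
    by_cases h : ((S :: T :: l).length : ℕ∞) ≤ N
    · refine Or.inr ⟨_, graftWord_eq _ (by simp) h, ?_⟩
      simp only [optLabels, Option.elim, MagTree.labels]
      rw [← List.sum_ofFn]
      exact congrArg List.sum ((List.map_ofFn (f := (S :: T :: l).get)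
        (g := MagTree.labels)).symm.trans (by rw [List.ofFn_get]))
    · exact Or.inl (by rw [graftWord, dif_neg h])

lemma map_graft_mem {α : Multiset X} {t : Forests K N X ⊗[K] Forests K N X}
    (ht : t ∈ contentForest K N X α) :
    TensorProduct.map (graft K N X) (graft K N X) t ∈ contentTensor K N X α := by
  refine (Submodule.span_le (p := (contentTensor K N X α).comap _)).2 ?_ ht
  rintro _ ⟨v, w, h, rfl⟩
  simp only [SetLike.mem_coe, Submodule.mem_comap, TensorProduct.map_tmul, graft_of]
  rcases graftWord_eq_basis (K := K) v.toList with hv | ⟨S, hv, hS⟩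
  · rw [hv, TensorProduct.zero_tmul]; exact zero_mem _
  rcases graftWord_eq_basis (K := K) w.toList with hw | ⟨T, hw, hT⟩
  · rw [hw, TensorProduct.tmul_zero]; exact zero_mem _
  exact Submodule.subset_span ⟨S, T, by rw [hS, hT, ← h]; rfl, by rw [hv, hw]⟩

lemma contentForest_mul {α β : Multiset X} {s t : Forests K N X ⊗[K] Forests K N X}
    (hs : s ∈ contentForest K N X α) (ht : t ∈ contentForest K N X β) :
    s * t ∈ contentForest K N X (α + β) := by
  have := Submodule.mul_mem_mul hs ht
  rw [contentForest, contentForest, Submodule.span_mul_span] at this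
  refine Submodule.span_mono ?_ this
  rintro _ ⟨_, ⟨v, w, h, rfl⟩, _, ⟨v', w', h', rfl⟩, rfl⟩
  refine ⟨v * v', w * w', ?_, by simp⟩
  rw [← h, ← h']
  simp only [forestLabels, FreeMonoid.toList_mul, List.map_append, List.sum_append]
  abel

lemma coaddTree_mem (T : MagTree N X) : coaddTree K T ∈ contentTensor K N X T.labels := by
  induction T with
  | leaf x =>
    exact add_mem (Submodule.subset_span ⟨some (.leaf x), none, by simp [optLabels], rfl⟩)
      (Submodule.subset_span ⟨none, some (.leaf x), by simp [optLabels], rfl⟩)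
  | node k h2 hN c ih =>
    rw [coaddTree, veeTensor, transportOp_apply, MagTree.labels]
    refine map_graft_mem ?_
    clear h2 hN
    induction k with
    | zero =>
      simp only [List.ofFn_zero, List.prod_nil, Finset.univ_eq_empty, Finset.sum_empty]
      exact Submodule.subset_span ⟨1, 1, rfl, rfl⟩
    | succ k ihk =>
      rw [List.ofFn_succ, List.prod_cons, Fin.sum_univ_succ]
      exact contentForest_mul (map_toForest_mem (ih 0)) (ihk _ fun i => ih i.succ)

variable (K N X) in
/-- The value `⟨f ⊗ g, Δ_a(a)⟩` of the dual `Δ_a^*(⟨f,·⟩ ⊗ ⟨g,·⟩)` of the co-addition at `a`. -/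
def dualCoadd (f g a : FreeMag K N X) : K :=
  LinearMap.mul' K K (TensorProduct.map (pairing K N X f) (pairing K N X g) (coadd K N X a))

lemma pairing_basis (f : FreeMag K N X) (o : Option (MagTree N X)) :
    pairing K N X f (treeBasis K N X o) = (treeBasis K N X).repr f o := by
  have : (pairing K N X).flip (treeBasis K N X o) = (treeBasis K N X).coord o :=
    (treeBasis K N X).ext fun i => by
      classical
      simp [pairing, Finsupp.single_apply, eq_comm]
  exact LinearMap.congr_fun this f

lemma coadd_basis_mem (o : Option (MagTree N X)) :
    coadd K N X (treeBasis K N X o) ∈ contentTensor K N X (optLabels o) := by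
  rcases o with _ | T
  · exact (congrArg (· ∈ contentTensor K N X 0) coadd_one).mpr
      (Submodule.subset_span ⟨none, none, rfl, rfl⟩)
  · exact (congrArg (· ∈ contentTensor K N X T.labels) (coadd_ofTree T)).mpr (coaddTree_mem T)

lemma dualCoadd_finite (f g : FreeMag K N X) :
    {o | dualCoadd K N X f g (treeBasis K N X o) ≠ 0}.Finite := by
  have hfin : (⋃ S ∈ ((treeBasis K N X).repr f).support, ⋃ T ∈ ((treeBasis K N X).repr g).support,
      {o : Option (MagTree N X) | optLabels o = optLabels S + optLabels T}).Finite :=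
    Set.Finite.biUnion (Finset.finite_toSet _) fun S _ =>
      Set.Finite.biUnion (Finset.finite_toSet _) fun T _ => finite_optLabels_eq _
  refine hfin.subset fun o ho => ?_
  by_contra hcon
  apply ho
  let F : FreeMag K N X ⊗[K] FreeMag K N X →ₗ[K] K :=
    LinearMap.mul' K K ∘ₗ TensorProduct.map (pairing K N X f) (pairing K N X g)
  refine (Submodule.span_le (p := LinearMap.ker F)).2 ?_ (coadd_basis_mem o)
  rintro _ ⟨S, T, h, rfl⟩
  simp only [SetLike.mem_coe, LinearMap.mem_ker, F, LinearMap.comp_apply, TensorProduct.map_tmul,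
    LinearMap.mul'_apply, pairing_basis]
  by_contra hne
  apply hcon
  simp only [Set.mem_iUnion]
  exact ⟨S, by simpa using left_ne_zero_of_mul hne, T, by simpa using right_ne_zero_of_mul hne,
    h.symm⟩

variable (K N X) in
/-- The planar shuffle product, the dual of the co-addition `Δ_a` under the identification of
trees with the elements of the dual basis: the coefficient of a tree `T` in `f ⧢ g` is
`⟨f ⊗ g, Δ_a(T)⟩`. -/
def shuffle (f g : FreeMag K N X) : FreeMag K N X :=
  (treeBasis K N X).repr.symm
    (Finsupp.ofSupportFinite (fun o => dualCoadd K N X f g (treeBasis K N X o))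
      (dualCoadd_finite f g))

/-- `⟨f ⧢ g, a⟩ = ⟨f ⊗ g, Δ_a(a)⟩`. -/
lemma pairing_shuffle (f g a : FreeMag K N X) :
    pairing K N X (shuffle K N X f g) a = dualCoadd K N X f g a := by
  have : pairing K N X (shuffle K N X f g) = LinearMap.mul' K K ∘ₗ
      TensorProduct.map (pairing K N X f) (pairing K N X g) ∘ₗ coadd K N X :=
    (treeBasis K N X).ext fun o => by
      rw [pairing_basis, shuffle, LinearEquiv.apply_symm_apply]
      rfl
  exact LinearMap.congr_fun this a

open WithConv in
/-- The pairing, as a map to the convolution algebra dual to the coalgebra `(A, Δ_a)`. -/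
def toConvDual (f : FreeMag K N X) : WithConv (FreeMag K N X →ₗ[K] K) := toConv (pairing K N X f)

lemma toConvDual_injective : Function.Injective (toConvDual (K := K) (N := N) (X := X)) := fun f g h => by
  apply (treeBasis K N X).repr.injective
  ext o
  rw [← pairing_basis, ← pairing_basis]
  exact congrArg (fun φ => φ.ofConv (treeBasis K N X o)) h

lemma toConvDual_add (f g : FreeMag K N X) : toConvDual (f + g) = toConvDual f + toConvDual g := by
  simp [toConvDual]

lemma toConvDual_smul (c : K) (f : FreeMag K N X) : toConvDual (c • f) = c • toConvDual f := by
  simp [toConvDual]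

lemma toConvDual_shuffle (f g : FreeMag K N X) :
    toConvDual (shuffle K N X f g) = toConvDual f * toConvDual g := by
  ext a
  exact pairing_shuffle f g a

lemma toConvDual_one : toConvDual (1 : FreeMag K N X) = 1 := by
  have : pairing K N X 1 = augmentation K N X := (treeBasis K N X).constr_basis K _ none
  ext a
  exact LinearMap.congr_fun this a

/-- The commutative algebra `(A, ⧢)`: multiplication in `FreeMag K N X` is the shuffle product. -/
instance : CommRing (FreeMag K N X) where
  __ := (inferInstance : AddCommGroup (FreeMag K N X))
  mul := shuffle K N X
  one := 1
  left_distrib f g h := toConvDual_injective <| by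
    change toConvDual (shuffle K N X f (g + h)) = toConvDual (shuffle K N X f g + shuffle K N X f h)
    simp only [toConvDual_shuffle, toConvDual_add, mul_add]
  right_distrib f g h := toConvDual_injective <| by
    change toConvDual (shuffle K N X (f + g) h) = toConvDual (shuffle K N X f h + shuffle K N X g h)
    simp only [toConvDual_shuffle, toConvDual_add, add_mul]
  zero_mul f := toConvDual_injective <| by
    change toConvDual (shuffle K N X 0 f) = toConvDual 0
    have : toConvDual (0 : FreeMag K N X) = 0 := by simp [toConvDual]
    rw [toConvDual_shuffle, this, zero_mul]
  mul_zero f := toConvDual_injective <| by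
    change toConvDual (shuffle K N X f 0) = toConvDual 0
    have : toConvDual (0 : FreeMag K N X) = 0 := by simp [toConvDual]
    rw [toConvDual_shuffle, this, mul_zero]
  mul_assoc f g h := toConvDual_injective <| by
    change toConvDual (shuffle K N X (shuffle K N X f g) h) =
      toConvDual (shuffle K N X f (shuffle K N X g h))
    simp only [toConvDual_shuffle, mul_assoc]
  one_mul f := toConvDual_injective <| by
    change toConvDual (shuffle K N X 1 f) = toConvDual f
    rw [toConvDual_shuffle, toConvDual_one, one_mul]
  mul_one f := toConvDual_injective <| by
    change toConvDual (shuffle K N X f 1) = toConvDual f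
    rw [toConvDual_shuffle, toConvDual_one, mul_one]
  mul_comm f g := toConvDual_injective <| by
    change toConvDual (shuffle K N X f g) = toConvDual (shuffle K N X g f)
    rw [toConvDual_shuffle, toConvDual_shuffle, mul_comm]

lemma mul_eq_shuffle (f g : FreeMag K N X) : f * g = shuffle K N X f g := rfl

instance : Algebra K (FreeMag K N X) :=
  Algebra.ofModule
    (fun c f g => toConvDual_injective <| by
      simp only [mul_eq_shuffle, toConvDual_shuffle, toConvDual_smul, smul_mul_assoc])
    (fun c f g => toConvDual_injective <| by
      simp only [mul_eq_shuffle, toConvDual_shuffle, toConvDual_smul, mul_smul_comm])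

end basic

/-! ### Grading, primitive elements, orthogonal complement -/

/-- The degree of a possibly empty tree. -/
def treeDegree : Option (MagTree N X) → ℕ
  | none => 0
  | some T => T.degree

/-- The homogeneous component `A^{(n)}`: the span of the trees of degree `n`. -/
def homogeneous (n : ℕ) : Submodule K (FreeMag K N X) :=
  Submodule.span K (treeBasis K N X '' {o | treeDegree N X o = n})

/-- The space `Prim A` of primitive elements: `Δ_a(f) = f ⊗ 1 + 1 ⊗ f`. -/
def prim : Submodule K (FreeMag K N X) where
  carrier := {f | coadd K N X f = f ⊗ₜ 1 + 1 ⊗ₜ f}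
  zero_mem' := by simp
  add_mem' {f g} hf hg := by
    change coadd K N X (f + g) = (f + g) ⊗ₜ 1 + 1 ⊗ₜ (f + g)
    rw [map_add, hf, hg, TensorProduct.add_tmul, TensorProduct.tmul_add]; abel
  smul_mem' c f hf := by
    change coadd K N X (c • f) = (c • f) ⊗ₜ 1 + 1 ⊗ₜ (c • f)
    rw [map_smul, hf, smul_add, TensorProduct.smul_tmul', TensorProduct.tmul_smul]

/-- The homogeneous primitive elements of degree `n`, `Prim A^{(n)}`. -/
def primDeg (n : ℕ) : Submodule K (FreeMag K N X) := prim K N X ⊓ homogeneous K N X n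

/-- The orthogonal complement `B^{(n)}` of `Prim A^{(n)}` in `A^{(n)}`. -/
def primPerp (n : ℕ) : Submodule K (FreeMag K N X) where
  carrier := {g | g ∈ homogeneous K N X n ∧ ∀ f ∈ primDeg K N X n, pairing K N X f g = 0}
  zero_mem' := ⟨zero_mem _, by simp⟩
  add_mem' hf hg := ⟨add_mem hf.1 hg.1, fun p hp => by rw [map_add, hf.2 p hp, hg.2 p hp, add_zero]⟩
  smul_mem' c f hf := ⟨Submodule.smul_mem _ c hf.1, fun p hp => by
    rw [map_smul, hf.2 p hp, smul_zero]⟩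

end FreeMag

end

open scoped TensorProduct

noncomputable section

/-! The argument rests on the duality between the shuffle product and `Δ_a`. The coefficient of
`Δ_a(f)` at `s ⊗ t` is `⟨s ⧢ t, f⟩`, so an element is primitive exactly when its coefficient at the
empty tree vanishes and it is orthogonal to every shuffle product of two non-empty trees
(`mem_prim_iff`).

Generation. For `n > 0`, each tree of degree `n` is a primitive element plus a combination of
products of elements of lower positive degree (`ofTree_mem_sup`, `primDeg_sup_decomposable`). Over a
general field of characteristic zero the form may have isotropic vectors, so an orthogonal
projection is not available for free. The structure constants of `⧢` are natural numbers, however,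
so the projection can be computed over `ℚ`, where sums of squares detect zero. Hence the form is
non-degenerate on `Prim A^{(n)}` (`eq_zero_of_mem_primDeg`), the orthogonal complement of `Prim
A^{(n)}` is the space of decomposables (`primPerp_eq_decomposable`), and by induction on the degree
the primitives generate `A`.

Freeness. For a primitive `p`, the operator `h ↦ ∨²(h, p)` is a coderivation of `Δ_a`, so its
transpose is a derivation of the dual convolution algebra, which contains `(A, ⧢)`. On elements of
degree at most `deg p` this derivation takes the constant value `⟨f, p⟩`. Take a polynomial relation
among linearly independent homogeneous primitives and apply the derivations for all `p` of the top
degree `d` among its variables. This gives linear relations between the evaluated partial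
derivatives, with coefficients `⟨f_i, p⟩`. Non-degeneracy and linear independence force each partial
derivative in a variable of degree `d` to be a relation again. Descent on the total degree, in
characteristic zero, gives algebraic independence (`algebraicIndependent_of_linearIndependent`).

Part (i) combines the two halves for a homogeneous basis of `W`. For part (ii), the monomials of
degree `n` in primitives of degree below `n` span the decomposables, and algebraic independence
makes them a basis. -/

lemma MagTree.degree_pos {N : ℕ∞} {X : Type*} (T : MagTree N X) : 0 < T.degree := by
  induction T with
  | leaf x => simp [MagTree.degree, MagTree.labels]
  | node k h2 hN c ih =>
    have h : (MagTree.node k h2 hN c).degree = ∑ i, (c i).degree := by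
      simp [MagTree.degree, MagTree.labels]
    rw [h]
    exact Finset.sum_pos (fun i _ => ih i) ⟨⟨0, by omega⟩, Finset.mem_univ _⟩

namespace FreeMag

/-! ### Grading, orthogonality, and primitivity as orthogonality to products -/

section grading

variable {K : Type*} [Field K] {N : ℕ∞} {X : Type*}

/-! ### Homogeneous components -/

lemma pairing_basis_left (o : Option (MagTree N X)) (f : FreeMag K N X) :
    pairing K N X (treeBasis K N X o) f = (treeBasis K N X).repr f o := by
  simp [pairing]

lemma pairing_comm (f g : FreeMag K N X) : pairing K N X f g = pairing K N X g f := by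
  have : pairing K N X f = (pairing K N X).flip f := (treeBasis K N X).ext fun o => by
    rw [pairing_basis, LinearMap.flip_apply, pairing_basis_left]
  exact LinearMap.congr_fun this g

lemma eq_zero_of_pairing_eq_zero {f : FreeMag K N X}
    (h : ∀ o, pairing K N X f (treeBasis K N X o) = 0) : f = 0 := by
  apply (treeBasis K N X).repr.injective
  ext o
  rw [← pairing_basis, h, map_zero]; rfl

lemma treeDegree_eq_card (o : Option (MagTree N X)) :
    treeDegree N X o = Multiset.card (optLabels o) := by
  rcases o with _ | T <;> rfl

lemma mem_homogeneous_iff {n : ℕ} {f : FreeMag K N X} :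
    f ∈ homogeneous K N X n ↔ ∀ o, (treeBasis K N X).repr f o ≠ 0 → treeDegree N X o = n := by
  rw [homogeneous, Module.Basis.mem_span_image]
  simp [Set.subset_def]

lemma basis_mem_homogeneous (o : Option (MagTree N X)) :
    treeBasis K N X o ∈ homogeneous K N X (treeDegree N X o) :=
  Submodule.subset_span ⟨o, rfl, rfl⟩

lemma ofTree_mem_homogeneous (T : MagTree N X) :
    ofTree T ∈ homogeneous K N X T.degree :=
  basis_mem_homogeneous (some T)

variable (K N X) in
/-- The projection of `A` onto its homogeneous component of degree `n`. -/
def homogeneousComponent (n : ℕ) : FreeMag K N X →ₗ[K] FreeMag K N X :=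
  (treeBasis K N X).constr K fun o => if treeDegree N X o = n then treeBasis K N X o else 0

lemma homogeneousComponent_basis (n : ℕ) (o : Option (MagTree N X)) :
    homogeneousComponent K N X n (treeBasis K N X o) =
      if treeDegree N X o = n then treeBasis K N X o else 0 :=
  (treeBasis K N X).constr_basis K _ o

lemma homogeneousComponent_mem (n : ℕ) (f : FreeMag K N X) :
    homogeneousComponent K N X n f ∈ homogeneous K N X n := by
  have : LinearMap.range (homogeneousComponent K N X n) ≤ homogeneous K N X n := by
    rw [homogeneousComponent, Module.Basis.constr_range, Submodule.span_le]
    rintro _ ⟨o, rfl⟩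
    dsimp only
    split_ifs with h
    · exact h ▸ basis_mem_homogeneous o
    · exact zero_mem _
  exact this ⟨f, rfl⟩

lemma homogeneousComponent_of_mem {m : ℕ} {f : FreeMag K N X} (hf : f ∈ homogeneous K N X m)
    (n : ℕ) : homogeneousComponent K N X n f = if m = n then f else 0 := by
  induction hf using Submodule.span_induction with
  | mem x hx => obtain ⟨o, rfl, rfl⟩ := hx; exact homogeneousComponent_basis n o
  | zero => simp
  | add x y _ _ hx hy => rw [map_add, hx, hy]; split_ifs <;> simp
  | smul c x _ hx => rw [map_smul, hx]; split_ifs <;> simp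

lemma exists_sum_homogeneousComponent (f : FreeMag K N X) :
    ∃ s : Finset ℕ, f = ∑ n ∈ s, homogeneousComponent K N X n f := by
  classical
  obtain ⟨c, rfl⟩ := (treeBasis K N X).repr.symm.surjective f
  refine ⟨c.support.image (treeDegree N X), ?_⟩
  rw [Module.Basis.repr_symm_apply, Finsupp.linearCombination_apply, Finsupp.sum]
  simp only [map_sum, map_smul, homogeneousComponent_basis]
  rw [Finset.sum_comm]
  refine Finset.sum_congr rfl fun o ho => ?_
  rw [← Finset.smul_sum, Finset.sum_ite_eq, if_pos (Finset.mem_image_of_mem _ ho)]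

lemma iSupIndep_homogeneous : iSupIndep fun n => homogeneous K N X n := by
  rw [iSupIndep_def]
  intro n
  rw [Submodule.disjoint_def]
  intro f hf hf'
  have h0 : (⨆ (m) (_ : m ≠ n), homogeneous K N X m) ≤
      LinearMap.ker (homogeneousComponent K N X n) :=
    iSup₂_le fun m hm g hg => by
      rw [LinearMap.mem_ker, homogeneousComponent_of_mem hg, if_neg hm]
  have := h0 hf'
  rwa [LinearMap.mem_ker, homogeneousComponent_of_mem hf, if_pos rfl] at this

lemma pairing_homogeneous {m n : ℕ} (hmn : m ≠ n) {f g : FreeMag K N X}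
    (hf : f ∈ homogeneous K N X m) (hg : g ∈ homogeneous K N X n) :
    pairing K N X f g = 0 := by
  induction hg using Submodule.span_induction with
  | mem x hx =>
    obtain ⟨o, rfl, rfl⟩ := hx
    rw [pairing_basis]
    by_contra h
    exact hmn (mem_homogeneous_iff.1 hf o h).symm
  | zero => simp
  | add x y _ _ hx hy => rw [map_add, hx, hy, add_zero]
  | smul c x _ hx => rw [map_smul, hx, smul_zero]

lemma pairing_homogeneousComponent {m n : ℕ} {f : FreeMag K N X} (hf : f ∈ homogeneous K N X m)
    (g : FreeMag K N X) : pairing K N X f (homogeneousComponent K N X n g) =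
      if m = n then pairing K N X f g else 0 := by
  have : pairing K N X f ∘ₗ homogeneousComponent K N X n =
      if m = n then pairing K N X f else 0 := (treeBasis K N X).ext fun o => by
    rw [LinearMap.comp_apply, homogeneousComponent_basis]
    split_ifs with h h' h'
    · rfl
    · exact pairing_homogeneous (fun e => h' (e.trans h)) hf (basis_mem_homogeneous o)
    · rw [map_zero, pairing_homogeneous (fun e => h (e.symm.trans h')) hf
        (basis_mem_homogeneous o)]
    · simp
  rw [← LinearMap.comp_apply, this]
  split_ifs <;> rfl

/-! ### Coefficients of shuffle products -/

lemma pairing_mul (f g a : FreeMag K N X) :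
    pairing K N X (f * g) a = dualCoadd K N X f g a :=
  pairing_shuffle f g a

lemma dualCoadd_basis (s t : Option (MagTree N X)) (a : FreeMag K N X) :
    dualCoadd K N X (treeBasis K N X s) (treeBasis K N X t) a =
      ((treeBasis K N X).tensorProduct (treeBasis K N X)).repr (coadd K N X a) (s, t) := by
  have : LinearMap.mul' K K ∘ₗ TensorProduct.map (pairing K N X (treeBasis K N X s))
      (pairing K N X (treeBasis K N X t)) =
      ((treeBasis K N X).tensorProduct (treeBasis K N X)).coord (s, t) :=
    TensorProduct.ext' fun f g => by
      simp [pairing_basis_left, Module.Basis.tensorProduct_repr_tmul_apply, mul_comm]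
  exact LinearMap.congr_fun this _

/-- The co-addition distributes the leaves of a tree over the two tensor factors, so the shuffle
product adds leaf contents. Content is finer than degree, and only finitely many trees share a
content even when `X` is infinite. -/
lemma pairing_mul_basis_ne_zero {s t o : Option (MagTree N X)}
    (h : pairing K N X (treeBasis K N X s * treeBasis K N X t) (treeBasis K N X o) ≠ 0) :
    optLabels s + optLabels t = optLabels o := by
  classical
  by_contra hne
  apply h
  rw [pairing_mul, dualCoadd_basis]
  refine (Submodule.span_le (p := LinearMap.ker
    (((treeBasis K N X).tensorProduct (treeBasis K N X)).coord (s, t)))).2 ?_ (coadd_basis_mem o)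
  rintro _ ⟨S, T, hST, rfl⟩
  rw [SetLike.mem_coe, LinearMap.mem_ker, ← Module.Basis.tensorProduct_apply,
    Module.Basis.coord_apply, Module.Basis.repr_self, Finsupp.single_apply, if_neg]
  rintro ⟨⟩
  exact hne hST

lemma mul_mem_homogeneous {i j : ℕ} {f g : FreeMag K N X} (hf : f ∈ homogeneous K N X i)
    (hg : g ∈ homogeneous K N X j) : f * g ∈ homogeneous K N X (i + j) := by
  have := Submodule.mul_mem_mul hf hg
  rw [homogeneous, homogeneous, Submodule.span_mul_span] at this
  refine Submodule.span_le.2 ?_ this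
  rintro _ ⟨_, ⟨s, rfl, rfl⟩, _, ⟨t, rfl, rfl⟩, rfl⟩
  refine mem_homogeneous_iff.2 fun o ho => ?_
  rw [← pairing_basis] at ho
  rw [treeDegree_eq_card, treeDegree_eq_card, treeDegree_eq_card,
    ← pairing_mul_basis_ne_zero ho, Multiset.card_add]

lemma one_mem_homogeneous : (1 : FreeMag K N X) ∈ homogeneous K N X 0 :=
  basis_mem_homogeneous none

lemma augmentation_eq_pairing (f : FreeMag K N X) :
    augmentation K N X f = pairing K N X 1 f :=
  (pairing_basis_left none f).symm

/-! ### Primitive elements -/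

/-- Compare coefficients at `s ⊗ t`. If `s` or `t` is empty, the product is the other factor, and
the equation follows once the coefficient at the empty tree is zero; for `s`, `t` both non-empty the
right-hand side has coefficient zero. -/
lemma mem_prim_iff {f : FreeMag K N X} : f ∈ prim K N X ↔
    augmentation K N X f = 0 ∧ ∀ S T : MagTree N X, pairing K N X (ofTree S * ofTree T) f = 0 := by
  have key : f ∈ prim K N X ↔ ∀ s t, pairing K N X (treeBasis K N X s * treeBasis K N X t) f =
      (treeBasis K N X).repr f s * (treeBasis K N X).repr 1 t +
      (treeBasis K N X).repr 1 s * (treeBasis K N X).repr f t := by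
    change coadd K N X f = f ⊗ₜ 1 + 1 ⊗ₜ f ↔ _
    rw [← ((treeBasis K N X).tensorProduct (treeBasis K N X)).repr.injective.eq_iff,
      Finsupp.ext_iff, Prod.forall]
    refine forall₂_congr fun s t => ?_
    rw [pairing_mul, dualCoadd_basis, map_add, Finsupp.add_apply,
      Module.Basis.tensorProduct_repr_tmul_apply, Module.Basis.tensorProduct_repr_tmul_apply,
      smul_eq_mul, smul_eq_mul, mul_comm ((treeBasis K N X).repr 1 t),
      mul_comm ((treeBasis K N X).repr f t)]
  have h1 : ∀ S : MagTree N X, (treeBasis K N X).repr 1 (some S) = 0 := fun S => by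
    change (treeBasis K N X).repr (treeBasis K N X none) (some S) = 0
    simp
  have h0 : (treeBasis K N X).repr (1 : FreeMag K N X) none = 1 := by
    change (treeBasis K N X).repr (treeBasis K N X none) none = 1
    simp
  have hb : treeBasis K N X none = 1 := rfl
  have hf : (treeBasis K N X).repr f none = augmentation K N X f := rfl
  rw [key]
  refine ⟨fun h => ⟨?_, fun S T => ?_⟩, fun ⟨he, h⟩ s t => ?_⟩
  · have := h none none
    rw [hb, mul_one, ← augmentation_eq_pairing, h0, mul_one, one_mul, hf] at this
    simpa using this
  · refine (h (some S) (some T)).trans ?_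
    rw [h1, h1, mul_zero, zero_mul, add_zero]
  · rcases s with _ | S <;> rcases t with _ | T
    · rw [hb, mul_one, ← augmentation_eq_pairing, hf, he]; simp
    · rw [hb, one_mul, pairing_basis_left, h0, h1]; simp
    · rw [hb, mul_one, pairing_basis_left, h0, h1]; simp
    · refine (h S T).trans ?_
      rw [h1, h1, mul_zero, zero_mul, add_zero]

/-- Each condition in `mem_prim_iff` is a pairing with a homogeneous element, so it passes to the
homogeneous components. -/
lemma homogeneousComponent_mem_primDeg {f : FreeMag K N X} (hf : f ∈ prim K N X) (n : ℕ) :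
    homogeneousComponent K N X n f ∈ primDeg K N X n := by
  refine ⟨mem_prim_iff.2 ?_, homogeneousComponent_mem n f⟩
  rw [mem_prim_iff] at hf
  refine ⟨?_, fun S T => ?_⟩
  · rw [augmentation_eq_pairing, pairing_homogeneousComponent one_mem_homogeneous,
      ← augmentation_eq_pairing, hf.1, ite_self]
  · rw [pairing_homogeneousComponent
      (mul_mem_homogeneous (ofTree_mem_homogeneous S) (ofTree_mem_homogeneous T)), hf.2, ite_self]

lemma iSupIndep_primDeg : iSupIndep fun n => primDeg K N X n :=
  iSupIndep_homogeneous.mono fun _ => inf_le_right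

lemma iSup_primDeg : ⨆ n, primDeg K N X n = prim K N X := by
  refine le_antisymm (iSup_le fun _ => inf_le_left) fun f hf => ?_
  obtain ⟨s, hs⟩ := exists_sum_homogeneousComponent f
  rw [hs]
  exact Submodule.sum_mem _ fun n _ =>
    Submodule.mem_iSup_of_mem n (homogeneousComponent_mem_primDeg hf n)

lemma primDeg_zero : primDeg K N X 0 = ⊥ := by
  refine (Submodule.eq_bot_iff _).2 fun f hf => ?_
  refine eq_zero_of_pairing_eq_zero fun o => ?_
  rcases o with _ | T
  · rw [pairing_basis]; exact (mem_prim_iff.1 hf.1).1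
  · refine pairing_homogeneous ?_ hf.2 (basis_mem_homogeneous (some T))
    have := MagTree.degree_pos T
    exact this.ne

end grading

end FreeMag

end

/-! ### Splitting of each degree into primitive and decomposable elements -/

noncomputable section

/-- Over `ℚ`, the columns of `M` lie in the column space of the Gram matrix `M * Mᵀ`. -/
lemma Matrix.exists_mul_transpose_mul_eq {m n : Type*} [Fintype m] [Fintype n]
    (M : Matrix m n ℚ) : ∃ Z : Matrix m n ℚ, M * M.transpose * Z = M := by
  classical
  have hle : LinearMap.range (M * M.transpose).mulVecLin ≤ LinearMap.range M.mulVecLin := by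
    rintro _ ⟨v, rfl⟩
    exact ⟨M.transpose.mulVec v, Matrix.mulVec_mulVec v M M.transpose⟩
  -- Equality of ranks uses the order on `ℚ`: `vᵀ M Mᵀ v` is a sum of squares, so `M Mᵀ v = 0`
  -- forces `Mᵀ v = 0`.
  have heq := Submodule.eq_of_le_of_finrank_eq hle M.rank_self_mul_transpose
  have : ∀ j, ∃ v, (M * M.transpose).mulVec v = M.col j := fun j => by
    have : M.col j ∈ LinearMap.range M.mulVecLin := ⟨Pi.single j 1, by simp⟩
    rw [← heq] at this
    exact this
  choose v hv using this
  refine ⟨Matrix.of fun i j => v j i, ?_⟩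
  ext i j
  exact congrFun (hv j) i

namespace FreeMag

section decomposition

variable {K : Type*} [Field K] {N : ℕ∞} {X : Type*}

/-! ### Integrality of the structure constants -/

variable (K N X) in
/-- The pure tensors of words in `Forests ⊗ Forests`. -/
def tensorWords : Submonoid (Forests K N X ⊗[K] Forests K N X) where
  carrier := {t | ∃ v w, MonoidAlgebra.of K _ v ⊗ₜ MonoidAlgebra.of K _ w = t}
  one_mem' := ⟨1, 1, rfl⟩
  mul_mem' := by
    rintro _ _ ⟨v, w, rfl⟩ ⟨v', w', rfl⟩
    exact ⟨v * v', w * w', by simp⟩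

variable (K N X) in
/-- The sums of pure tensors of trees. -/
def tensorTrees : AddSubmonoid (FreeMag K N X ⊗[K] FreeMag K N X) :=
  AddSubmonoid.closure {t | ∃ S T, treeBasis K N X S ⊗ₜ treeBasis K N X T = t}

lemma map_toForest_mem_tensorWords {t : FreeMag K N X ⊗[K] FreeMag K N X}
    (ht : t ∈ tensorTrees K N X) :
    TensorProduct.map (toForest K N X) (toForest K N X) t ∈
      (tensorWords K N X).subsemiringClosure := by
  refine (AddSubmonoid.closure_le (S := (tensorWords K N X).subsemiringClosure.toAddSubmonoid.comap
    (TensorProduct.map (toForest K N X) (toForest K N X)).toAddMonoidHom)).2 ?_ ht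
  rintro _ ⟨S, T, rfl⟩
  refine AddSubmonoid.subset_closure ⟨FreeMonoid.ofList S.toList, FreeMonoid.ofList T.toList, ?_⟩
  rw [LinearMap.toAddMonoidHom_coe, TensorProduct.map_tmul, toForest_basis, toForest_basis, prod_of, prod_of]

lemma map_graft_mem_tensorTrees {t : Forests K N X ⊗[K] Forests K N X}
    (ht : t ∈ (tensorWords K N X).subsemiringClosure) :
    TensorProduct.map (graft K N X) (graft K N X) t ∈ tensorTrees K N X := by
  refine (AddSubmonoid.closure_le (S := (tensorTrees K N X).comap
    (TensorProduct.map (graft K N X) (graft K N X)).toAddMonoidHom)).2 ?_ ht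
  rintro _ ⟨v, w, rfl⟩
  rw [SetLike.mem_coe, AddSubmonoid.mem_comap, LinearMap.toAddMonoidHom_coe, TensorProduct.map_tmul, graft_of, graft_of]
  rcases graftWord_eq_basis (K := K) v.toList with hv | ⟨S, hv, hS⟩
  · rw [hv, TensorProduct.zero_tmul]; exact zero_mem _
  rcases graftWord_eq_basis (K := K) w.toList with hw | ⟨T, hw, hT⟩
  · rw [hw, TensorProduct.tmul_zero]; exact zero_mem _
  exact AddSubmonoid.subset_closure ⟨S, T, by rw [hv, hw]⟩

lemma coaddTree_mem_tensorTrees (T : MagTree N X) : coaddTree K T ∈ tensorTrees K N X := by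
  induction T with
  | leaf x =>
    exact add_mem (AddSubmonoid.subset_closure ⟨some (.leaf x), none, rfl⟩)
      (AddSubmonoid.subset_closure ⟨none, some (.leaf x), rfl⟩)
  | node k h2 hN c ih =>
    rw [coaddTree, veeTensor, transportOp_apply]
    refine map_graft_mem_tensorTrees (Subsemiring.list_prod_mem _ fun t ht => ?_)
    obtain ⟨i, rfl⟩ := (List.mem_ofFn' _ _).1 ht
    exact map_toForest_mem_tensorWords (ih i)

/-- Words multiply to words and grafting sends a word to a tree or to zero, so the recursion for
`Δ_a` never leaves the sums of pure tensors of trees. This integrality lets the linear algebra below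
be done over `ℚ`. -/
lemma exists_natCast_eq_pairing_mul (s t : Option (MagTree N X)) (T : MagTree N X) :
    ∃ m : ℕ, pairing K N X (treeBasis K N X s * treeBasis K N X t) (ofTree T) = m := by
  classical
  rw [pairing_mul, dualCoadd_basis, coadd_ofTree]
  have := (AddSubmonoid.closure_le (S := (AddMonoidHom.mrange (Nat.castAddMonoidHom K)).comap
    (((treeBasis K N X).tensorProduct (treeBasis K N X)).coord (s, t)).toAddMonoidHom)).2 ?_
    (coaddTree_mem_tensorTrees (K := K) T)
  · obtain ⟨m, hm⟩ := this
    exact ⟨m, hm.symm⟩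
  · rintro _ ⟨S, T, rfl⟩
    refine ⟨if (S, T) = (s, t) then 1 else 0, ?_⟩
    rw [LinearMap.toAddMonoidHom_coe, ← Module.Basis.tensorProduct_apply, Module.Basis.coord_apply, Module.Basis.repr_self,
      Finsupp.single_apply]
    simp

/-! ### Primitive and decomposable elements -/

variable (K N X) in
/-- The decomposable elements of degree `n`: the span of the products of homogeneous elements of
positive degree. -/
def decomposable (n : ℕ) : Submodule K (FreeMag K N X) :=
  Submodule.span K {a | ∃ i j, 0 < i ∧ 0 < j ∧ i + j = n ∧ ∃ f ∈ homogeneous K N X i,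
    ∃ g ∈ homogeneous K N X j, f * g = a}

lemma decomposable_le_homogeneous (n : ℕ) : decomposable K N X n ≤ homogeneous K N X n := by
  refine Submodule.span_le.2 ?_
  rintro _ ⟨i, j, -, -, rfl, f, hf, g, hg, rfl⟩
  exact mul_mem_homogeneous hf hg

lemma augmentation_of_mem_homogeneous {n : ℕ} (hn : 0 < n) {f : FreeMag K N X}
    (hf : f ∈ homogeneous K N X n) : augmentation K N X f = 0 := by
  rw [augmentation_eq_pairing]
  exact pairing_homogeneous hn.ne one_mem_homogeneous hf

/-- For primitive `p`, `⟨f ⧢ g, p⟩ = ⟨f, p⟩⟨g, 1⟩ + ⟨f, 1⟩⟨g, p⟩`, and both terms vanish when `f`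
and `g` have positive degree. -/
lemma decomposable_le_primPerp (n : ℕ) : decomposable K N X n ≤ primPerp K N X n := by
  refine Submodule.span_le.2 ?_
  rintro _ ⟨i, j, hi, hj, rfl, f, hf, g, hg, rfl⟩
  refine ⟨mul_mem_homogeneous hf hg, fun p hp => ?_⟩
  have hp' : coadd K N X p = p ⊗ₜ 1 + 1 ⊗ₜ p := hp.1
  rw [pairing_comm, pairing_mul, dualCoadd, hp', map_add, map_add, TensorProduct.map_tmul,
    TensorProduct.map_tmul, LinearMap.mul'_apply, LinearMap.mul'_apply,
    pairing_comm g 1, pairing_comm f 1, ← augmentation_eq_pairing, ← augmentation_eq_pairing,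
    augmentation_of_mem_homogeneous hi hf, augmentation_of_mem_homogeneous hj hg]
  simp

lemma pairing_eq_sum_of_support (F : Finset (Option (MagTree N X))) (f g : FreeMag K N X)
    (hg : ∀ o, pairing K N X g (treeBasis K N X o) ≠ 0 → o ∈ F) :
    pairing K N X f g = ∑ o ∈ F, pairing K N X f (treeBasis K N X o) *
      pairing K N X g (treeBasis K N X o) := by
  conv_lhs => rw [← (treeBasis K N X).linearCombination_repr g, Finsupp.linearCombination_apply]
  rw [Finsupp.sum_of_support_subset _ (s := F), map_sum]
  · refine Finset.sum_congr rfl fun o _ => ?_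
    rw [map_smul, smul_eq_mul, mul_comm, pairing_basis g]
  · intro o ho
    exact hg o (by rw [pairing_basis]; exact Finsupp.mem_support_iff.1 ho)
  · simp

lemma finite_labels_add_eq (α : Multiset X) :
    {p : MagTree N X × MagTree N X | p.1.labels + p.2.labels = α}.Finite := by
  classical
  refine ((Finset.finite_toSet α.antidiagonal.toFinset).biUnion fun q _ =>
    (finite_labels_eq q.1).prod (finite_labels_eq q.2)).subset fun p hp => ?_
  simp only [Set.mem_iUnion]
  exact ⟨(p.1.labels, p.2.labels), by simpa using hp, rfl, rfl⟩

variable [CharZero K]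

/-- Subtract from `U` a combination `d` of products of two trees chosen so that the difference is
orthogonal to all such products, hence primitive. The coefficients solve the normal equations, which
are solvable over `ℚ` and then transported to `K`. -/
lemma ofTree_mem_sup (U : MagTree N X) :
    ofTree U ∈ primDeg K N X U.degree ⊔ decomposable K N X U.degree := by
  classical
  -- Restricting to the leaf content of `U` keeps the system finite; fixing only the degree would
  -- not when `X` is infinite.
  let R := (finite_labels_add_eq (N := N) U.labels).toFinset
  let F := (finite_optLabels_eq (N := N) U.labels).toFinset
  have hF : ∀ o : F, ∃ T, o.1 = some T := by
    rintro ⟨_ | T, ho⟩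
    · have h0 : 0 = U.labels := by simpa [F, optLabels] using ho
      have := U.degree_pos
      rw [MagTree.degree, ← h0] at this
      exact absurd this (by simp)
    · exact ⟨T, rfl⟩
  let a : MagTree N X × MagTree N X → FreeMag K N X := fun p => ofTree p.1 * ofTree p.2
  have ha : ∀ p o, pairing K N X (a p) (treeBasis K N X o) ≠ 0 →
      p.1.labels + p.2.labels = optLabels o :=
    fun p o h => pairing_mul_basis_ne_zero (s := some p.1) (t := some p.2) h
  have hdeg : ∀ p ∈ R, p.1.degree + p.2.degree = U.degree := fun p hp => by
    have : p.1.labels + p.2.labels = U.labels := by simpa [R] using hp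
    rw [MagTree.degree, MagTree.degree, ← Multiset.card_add, this]; rfl
  have hc : ∀ (p : R) (o : F), ∃ m : ℕ, pairing K N X (a p) (treeBasis K N X o) = m :=
    fun p o => by
      obtain ⟨T, hT⟩ := hF o
      rw [hT]
      exact exists_natCast_eq_pairing_mul (some p.1.1) (some p.1.2) T
  choose c hc using hc
  -- With `c` the coefficient matrix of the products, `c cᵀ` is their Gram matrix, and the column of
  -- `Z` at `U` solves the normal equations whose right-hand side is the list of pairings of the
  -- products with `U`.
  obtain ⟨Z, hZ⟩ := Matrix.exists_mul_transpose_mul_eq (Matrix.of fun p o => (c p o : ℚ))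
  have hU : some U ∈ F := by simp [F, optLabels]
  let z : R → K := fun p => algebraMap ℚ K (Z p ⟨some U, hU⟩)
  let d : FreeMag K N X := ∑ p : R, z p • a p
  have hd : d ∈ decomposable K N X U.degree :=
    Submodule.sum_mem _ fun p _ => Submodule.smul_mem _ _ <| Submodule.subset_span
      ⟨_, _, p.1.1.degree_pos, p.1.2.degree_pos, hdeg p.1 p.2, _, ofTree_mem_homogeneous _, _,
        ofTree_mem_homogeneous _, rfl⟩
  have hw : ofTree U - d ∈ homogeneous K N X U.degree :=
    sub_mem (ofTree_mem_homogeneous U) (decomposable_le_homogeneous _ hd)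
  have haF : ∀ (p : R) o, pairing K N X (a p) (treeBasis K N X o) ≠ 0 → o ∈ F := fun p o h => by
    have h1 := ha _ _ h
    have h2 : p.1.1.labels + p.1.2.labels = U.labels := (finite_labels_add_eq U.labels).mem_toFinset.1 p.2
    simpa [F] using h1.symm.trans h2
  have hprim : ofTree U - d ∈ prim K N X := by
    refine mem_prim_iff.2 ⟨augmentation_of_mem_homogeneous U.degree_pos hw, fun S T => ?_⟩
    change pairing K N X (a (S, T)) _ = 0
    -- For a pair with the content of `U`, orthogonality is one row of the normal equations. For any
    -- other pair, the product shares no tree with `U` or with the summands of `d`.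
    by_cases hST : (S, T) ∈ R
    · let q : R := ⟨(S, T), hST⟩
      have hpair : ∀ p : R, pairing K N X (a q) (a p) =
          algebraMap ℚ K (∑ o : F, (c q o : ℚ) * c p o) := fun p => by
        rw [pairing_eq_sum_of_support F _ _ (haF p), ← Finset.sum_coe_sort]
        simp [hc]
      have hrow := congrArg (algebraMap ℚ K) (congrFun (congrFun hZ q) ⟨some U, hU⟩)
      rw [Matrix.mul_apply, map_sum] at hrow
      simp only [Matrix.mul_apply, Matrix.transpose_apply, Matrix.of_apply, map_mul] at hrow
      rw [map_sub, sub_eq_zero]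
      refine (hc q ⟨some U, hU⟩).trans ?_
      simp only [d, map_sum, map_smul, smul_eq_mul]
      refine (hrow.trans (by simp)).symm.trans (Finset.sum_congr rfl fun p _ => ?_)
      exact (mul_comm _ _).trans (congrArg (z p * ·) (hpair p).symm)
    · have hzero : ∀ o, o ∈ F → pairing K N X (a (S, T)) (treeBasis K N X o) = 0 := fun o ho => by
        by_contra h
        refine hST ?_
        have h1 := ha _ _ h
        have h2 : optLabels o = U.labels := by simpa [F] using ho
        simpa [R] using h1.trans h2
      rw [map_sub, map_sum]
      have h1 : pairing K N X (a (S, T)) (ofTree U) = 0 := hzero _ hU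
      rw [h1, zero_sub, neg_eq_zero]
      refine Finset.sum_eq_zero fun p _ => ?_
      rw [map_smul, pairing_eq_sum_of_support F _ _ (haF p), Finset.sum_eq_zero, smul_zero]
      intro o ho
      rw [hzero o ho, zero_mul]
  have := Submodule.add_mem_sup (show ofTree U - d ∈ primDeg K N X U.degree from ⟨hprim, hw⟩) hd
  rwa [sub_add_cancel] at this

lemma primDeg_sup_decomposable {n : ℕ} (hn : 0 < n) :
    primDeg K N X n ⊔ decomposable K N X n = homogeneous K N X n := by
  refine le_antisymm (sup_le inf_le_right (decomposable_le_homogeneous n)) ?_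
  refine Submodule.span_le.2 ?_
  rintro _ ⟨_ | U, rfl, rfl⟩
  · exact absurd hn (lt_irrefl 0)
  · exact ofTree_mem_sup U

/-- The pairing is non-degenerate on the homogeneous primitive elements of a given degree. -/
lemma eq_zero_of_mem_primDeg {n : ℕ} {p : FreeMag K N X} (hp : p ∈ primDeg K N X n)
    (h : ∀ q ∈ primDeg K N X n, pairing K N X p q = 0) : p = 0 := by
  rcases n.eq_zero_or_pos with rfl | hn
  · rwa [primDeg_zero, Submodule.mem_bot] at hp
  refine eq_zero_of_pairing_eq_zero fun o => ?_
  by_cases ho : treeDegree N X o = n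
  · have hb : treeBasis K N X o ∈ homogeneous K N X n := ho ▸ basis_mem_homogeneous o
    -- A primitive is always orthogonal to decomposables; being orthogonal to primitives as well,
    -- `p` is orthogonal to every tree of degree `n`.
    rw [← primDeg_sup_decomposable hn] at hb
    obtain ⟨q, hq, d, hd, hqd⟩ := Submodule.mem_sup.1 hb
    rw [← hqd, map_add, h q hq, (decomposable_le_primPerp n hd).2 p hp, add_zero]
  · exact pairing_homogeneous (Ne.symm ho) hp.2 (basis_mem_homogeneous o)

/-- Split `g = q + d` into a primitive and a decomposable part. Both `g` and `d` are orthogonal to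
the primitives, hence so is `q`, and non-degeneracy gives `q = 0`. -/
lemma primPerp_eq_decomposable {n : ℕ} (hn : 0 < n) :
    primPerp K N X n = decomposable K N X n := by
  refine le_antisymm (fun g hg => ?_) (decomposable_le_primPerp n)
  obtain ⟨q, hq, d, hd, rfl⟩ := Submodule.mem_sup.1 ((primDeg_sup_decomposable hn).ge hg.1)
  have : q = 0 := eq_zero_of_mem_primDeg hq fun p hp => by
    have h1 := hg.2 p hp
    rwa [map_add, (decomposable_le_primPerp n hd).2 p hp, add_zero, pairing_comm] at h1
  rwa [this, zero_add]

end decomposition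

end FreeMag

end

/-! ### Algebraic independence of primitives by differentiating relations -/

noncomputable section

namespace MvPolynomial

variable {K ι : Type*} [Field K]

lemma totalDegree_pderiv_lt [CharZero K] {P : MvPolynomial ι K} {j : ι}
    (h : pderiv j P ≠ 0) : (pderiv j P).totalDegree < P.totalDegree := by
  have key : ∀ m ∈ (pderiv j P).support, (m.sum fun _ e => e) < P.totalDegree := fun m hm => by
    rw [mem_support_iff, coeff_pderiv] at hm
    have := le_totalDegree (mem_support_iff.2 (left_ne_zero_of_mul hm))
    rw [Finsupp.sum_add_index' (by simp) (by simp), Finsupp.sum_single_index rfl] at this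
    omega
  obtain ⟨m, hm⟩ := support_nonempty.2 h
  exact (Finset.sup_lt_iff (lt_of_le_of_lt (Nat.zero_le _) (key m hm))).2 key

lemma pderiv_ne_zero [CharZero K] {P : MvPolynomial ι K} {j : ι} (hj : j ∈ P.vars) :
    pderiv j P ≠ 0 := by
  classical
  intro h
  obtain ⟨m, hm, hjm⟩ := (mem_vars_iff_mem_support j).1 hj
  have hle : Finsupp.single j 1 ≤ m := by
    rw [Finsupp.single_le_iff]
    exact Nat.one_le_iff_ne_zero.2 (Finsupp.mem_support_iff.1 hjm)
  have := coeff_pderiv (i := j) P (m - Finsupp.single j 1)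
  rw [h, coeff_zero, tsub_add_cancel_of_le hle] at this
  rcases mul_eq_zero.1 this.symm with h0 | h0
  · exact mem_support_iff.1 hm h0
  · exact Nat.cast_add_one_ne_zero _ h0

/-- In characteristic zero, a family is algebraically independent if every non-constant relation
can be differentiated to a relation with respect to one of its variables. -/
lemma algebraicIndependent_of_exists_pderiv [CharZero K] {B : Type*} [CommRing B] [Nontrivial B]
    [Algebra K B] {w : ι → B} (h : ∀ P : MvPolynomial ι K, aeval w P = 0 → P.vars.Nonempty →
      ∃ j ∈ P.vars, aeval w (pderiv j P) = 0) : AlgebraicIndependent K w := by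
  rw [algebraicIndependent_iff]
  intro P
  induction hn : P.totalDegree using Nat.strong_induction_on generalizing P with
  | _ n ih =>
    subst hn
    intro hP
    rcases P.vars.eq_empty_or_nonempty with h0 | h0
    · rw [vars_eq_empty_iff_eq_C] at h0
      rw [h0, aeval_C, map_eq_zero_iff _ (algebraMap K B).injective] at hP
      rw [h0, hP, map_zero]
    · obtain ⟨j, hj, hj0⟩ := h P hP h0
      exact absurd (ih _ (totalDegree_pderiv_lt (pderiv_ne_zero hj)) _ rfl hj0)
        (pderiv_ne_zero hj)

lemma derivation_aeval [Fintype ι] {B : Type*} [CommRing B] [Algebra K B] (D : Derivation K B B)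
    (w : ι → B) (P : MvPolynomial ι K) :
    D (aeval w P) = ∑ i, aeval w (pderiv i P) * D (w i) := by
  classical
  induction P using MvPolynomial.induction_on with
  | C c => simp
  | add P Q hP hQ => simp [hP, hQ, add_mul, Finset.sum_add_distrib]
  | mul_X P j hP =>
    simp only [map_mul, aeval_X, Derivation.leibniz, hP, smul_eq_mul, pderiv_X, map_add, add_mul,
      Finset.sum_add_distrib, Finset.mul_sum]
    congr 1
    · rw [Finset.sum_eq_single j]
      · simp
      · intro i _ hi; simp [Ne.symm hi]
      · simp
    · exact Finset.sum_congr rfl fun i _ => by ring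

end MvPolynomial

namespace FreeMag

section derivation

variable {K : Type*} [Field K] {N : ℕ∞} {X : Type*}

/-! ### Derivations of the shuffle algebra -/

/-- The operator `h ↦ ∨²(h, p)`. -/
def graftRight (p : FreeMag K N X) : FreeMag K N X →ₗ[K] FreeMag K N X :=
  graft K N X ∘ₗ LinearMap.mulRight K (toForest K N X p) ∘ₗ toForest K N X

lemma graftRight_apply (p h : FreeMag K N X) :
    graftRight p h = graft K N X (toForest K N X h * toForest K N X p) := rfl

lemma graftRight_eq_vee (p h : FreeMag K N X) : graftRight p h = vee K N X 2 ![h, p] := by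
  simp [graftRight_apply, vee, transportOp_apply]

/-- Since `Δ_a` is a morphism for `∨²`, grafting `p` on the right becomes grafting `p ⊗ 1 + 1 ⊗ p`
component-wise, and a unit argument leaves its factor unchanged. This coderivation rule dualizes to
the Leibniz rule. -/
lemma coadd_graftRight (hN : 2 ≤ N) {p : FreeMag K N X} (hp : p ∈ prim K N X)
    (h : FreeMag K N X) : coadd K N X (graftRight p h) =
      (graftRight p).rTensor _ (coadd K N X h) + (graftRight p).lTensor _ (coadd K N X h) := by
  have hp' : coadd K N X p = p ⊗ₜ 1 + 1 ⊗ₜ p := hp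
  rw [graftRight_eq_vee, coadd_vee 2 (by exact_mod_cast hN), veeTensor, transportOp_apply]
  simp only [List.ofFn_succ, List.ofFn_zero, List.prod_cons, List.prod_nil, mul_one,
    Fin.isValue, Matrix.cons_val_zero, Matrix.cons_val_succ, hp', map_add, TensorProduct.map_tmul,
    toForest_one]
  induction coadd K N X h with
  | zero => simp
  | tmul a b =>
    simp [mul_add, graftRight_apply, graft_toForest]
  | add s t hs ht =>
    rw [map_add, add_mul, map_add, hs, ht, map_add, map_add]
    abel

open WithConv in
/-- The transpose of `h ↦ ∨²(h, p)`, for a primitive element `p`, is a derivation of the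
convolution algebra dual to the coalgebra `(A, Δ_a)`. -/
def graftDerivation (hN : 2 ≤ N) {p : FreeMag K N X} (hp : p ∈ prim K N X) :
    Derivation K (WithConv (FreeMag K N X →ₗ[K] K)) (WithConv (FreeMag K N X →ₗ[K] K)) :=
  Derivation.mk'
    { toFun := fun φ => toConv (φ.ofConv ∘ₗ graftRight p)
      map_add' := fun φ ψ => rfl
      map_smul' := fun c φ => rfl } fun φ ψ => by
    ext h
    change LinearMap.mul' K K (TensorProduct.map φ.ofConv ψ.ofConv (coadd K N X (graftRight p h))) =
      LinearMap.mul' K K (TensorProduct.map φ.ofConv (ψ.ofConv ∘ₗ graftRight p) (coadd K N X h)) +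
      LinearMap.mul' K K (TensorProduct.map ψ.ofConv (φ.ofConv ∘ₗ graftRight p) (coadd K N X h))
    have key : ∀ t, LinearMap.mul' K K (TensorProduct.map ψ.ofConv (φ.ofConv ∘ₗ graftRight p)
        (TensorProduct.comm K _ _ t)) =
        LinearMap.mul' K K (TensorProduct.map (φ.ofConv ∘ₗ graftRight p) ψ.ofConv t) := fun t => by
      induction t with
      | zero => simp
      | tmul a b => simp [mul_comm]
      | add s t hs ht => simp only [map_add, hs, ht]
    have hcomm := key (coadd K N X h)
    rw [comm_coadd] at hcomm
    rw [coadd_graftRight hN hp, hcomm, add_comm, map_add, map_add, LinearMap.map_rTensor,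
      LinearMap.map_lTensor]

lemma graftRight_one (p : FreeMag K N X) : graftRight p 1 = p := by
  rw [graftRight_apply, toForest_one, one_mul, graft_toForest]

lemma graftRight_ofTree_mem (hN : 2 ≤ N) {m : ℕ} (hm : 0 < m) {p : FreeMag K N X}
    (hp : p ∈ homogeneous K N X m) (S : MagTree N X) :
    graftRight p (ofTree S) ∈ homogeneous K N X (S.degree + m) := by
  have : homogeneous K N X m ≤ (homogeneous K N X (S.degree + m)).comap
      (graft K N X ∘ₗ LinearMap.mulLeft K (toForest K N X (ofTree S)) ∘ₗ toForest K N X) := by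
    refine Submodule.span_le.2 ?_
    rintro _ ⟨_ | T, rfl, rfl⟩
    · exact absurd hm (lt_irrefl 0)
    · have h2 : ((2 : ℕ) : ℕ∞) ≤ N := by exact_mod_cast hN
      have h := vee_ofTree (K := K) (X := X) 2 le_rfl h2 ![S, T]
      have h' : (fun i => (ofTree (![S, T] i) : FreeMag K N X)) = ![(ofTree S : FreeMag K N X), ofTree T] := by
        ext i : 1
        fin_cases i <;> rfl
      rw [h', ← graftRight_eq_vee] at h
      change graftRight (ofTree T) (ofTree S) ∈ homogeneous K N X (S.degree + T.degree)
      rw [h]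
      have hd : (MagTree.node 2 le_rfl h2 ![S, T]).degree = S.degree + T.degree := by
        simp [MagTree.degree, MagTree.labels]
      exact hd ▸ ofTree_mem_homogeneous _
  exact this hp

/-- Grafting `p` to a non-empty tree produces degree greater than `m ≥ k`, which `f` cannot see.
Only the multiple of the empty tree in `h` contributes, through `∨²(1, p) = p`. -/
lemma pairing_graftRight (hN : 2 ≤ N) {k m : ℕ} (hm : 0 < m) (hkm : k ≤ m) {f p : FreeMag K N X}
    (hf : f ∈ homogeneous K N X k) (hp : p ∈ homogeneous K N X m) (h : FreeMag K N X) :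
    pairing K N X f (graftRight p h) = pairing K N X f p * augmentation K N X h := by
  have : pairing K N X f ∘ₗ graftRight p = pairing K N X f p • augmentation K N X := by
    refine tree_ext ?_ fun T => ?_
    · simp [graftRight_one, augmentation_one]
    · have := T.degree_pos
      rw [LinearMap.comp_apply,
        pairing_homogeneous (by omega) hf (graftRight_ofTree_mem hN hm hp T)]
      simp [augmentation_ofTree]
  exact LinearMap.congr_fun this h

lemma graftDerivation_toConvDual (hN : 2 ≤ N) {k m : ℕ} (hm : 0 < m) (hkm : k ≤ m)
    {f p : FreeMag K N X} (hf : f ∈ homogeneous K N X k) (hp : p ∈ primDeg K N X m) :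
    graftDerivation hN hp.1 (toConvDual f) =
      algebraMap K (WithConv (FreeMag K N X →ₗ[K] K)) (pairing K N X f p) := by
  ext h
  refine (pairing_graftRight hN hm hkm hf hp.2 h).trans ?_
  rw [Algebra.algebraMap_eq_smul_one]
  rfl

variable (K N X) in
/-- The embedding of the shuffle algebra into the dual of the coalgebra `(A, Δ_a)`. -/
def toConvDualHom : FreeMag K N X →ₐ[K] WithConv (FreeMag K N X →ₗ[K] K) :=
  AlgHom.ofLinearMap
    { toFun := toConvDual
      map_add' := toConvDual_add
      map_smul' := toConvDual_smul }
    toConvDual_one toConvDual_shuffle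

instance : Nontrivial (FreeMag K N X) :=
  ⟨1, 0, fun h => one_ne_zero (α := K) (by rw [← augmentation_one, h, map_zero])⟩

/-- Linearly independent homogeneous primitive elements are algebraically independent. -/
lemma algebraicIndependent_of_linearIndependent [CharZero K] (hN : 2 ≤ N) {ι : Type*}
    {f : ι → FreeMag K N X} {deg : ι → ℕ} (hf : ∀ i, f i ∈ primDeg K N X (deg i))
    (hlin : LinearIndependent K f) : AlgebraicIndependent K f := by
  refine algebraicIndependent_of_finite_type fun t ht => ?_
  have := ht.fintype
  refine MvPolynomial.algebraicIndependent_of_exists_pderiv fun P hP hvars => ?_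
  -- Maximality ensures that derivations coming from primitives of degree `deg j` take scalar values
  -- on all variables occurring in `P`.
  obtain ⟨j, hj, hmax⟩ := P.vars.exists_max_image (fun i => deg i) hvars
  refine ⟨j, hj, ?_⟩
  have hpos : 0 < deg j := Nat.pos_of_ne_zero fun h0 => by
    have h1 := hf j
    rw [h0, primDeg_zero, Submodule.mem_bot] at h1
    exact hlin.ne_zero _ h1
  let a : t → FreeMag K N X := fun i => MvPolynomial.aeval (fun i : t => f i)
    (MvPolynomial.pderiv i P)
  -- Indices of `t` that do not occur in `P` may have degree above `deg j`, where the derivation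
  -- need not be scalar; their terms drop out here.
  have ha : ∀ i, i ∉ P.vars → a i = 0 := fun i hi => by
    simp only [a, MvPolynomial.pderiv_eq_zero_of_notMem_vars hi, map_zero]
  -- This is the relation `P(f) = 0` differentiated by the chain rule in the dual algebra and pulled
  -- back along the injection of `A`.
  have hsum : ∀ p ∈ primDeg K N X (deg j), ∑ i : t, pairing K N X (f i) p • a i = 0 := fun p hp => by
    apply toConvDual_injective
    have h0 : graftDerivation hN hp.1
        (toConvDualHom K N X (MvPolynomial.aeval (fun i : t => f i) P)) = 0 := by
      rw [hP, map_zero, map_zero]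
    rw [MvPolynomial.comp_aeval_apply, MvPolynomial.derivation_aeval] at h0
    refine Eq.trans ?_ (h0.trans (map_zero (toConvDualHom K N X)).symm)
    change toConvDualHom K N X _ = _
    rw [map_sum]
    refine Finset.sum_congr rfl fun i _ => ?_
    rw [← MvPolynomial.comp_aeval_apply]
    change _ = toConvDualHom K N X (a i) * _
    by_cases hi : i ∈ P.vars
    · have h1 := graftDerivation_toConvDual hN hpos (hmax i hi) (hf i).2 hp
      have h2 : toConvDualHom K N X (f i) = toConvDual (f i) := rfl
      rw [h2, h1, map_smul, Algebra.smul_def, mul_comm]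
    · rw [ha i hi, smul_zero, map_zero, zero_mul]
  refine eq_zero_of_pairing_eq_zero fun o => ?_
  change pairing K N X (a j) _ = 0
  -- Reading `hsum` at the tree `o` says that `q` is orthogonal to `Prim A^{(deg j)}`; indices of
  -- other degrees are left out since they pair to zero with `p`. So `q = 0`, and linear
  -- independence kills its coefficient at `j`.
  let q : FreeMag K N X := ∑ i : t, (if deg i = deg j then
    pairing K N X (a i) (treeBasis K N X o) else 0) • f i
  have hq : q ∈ primDeg K N X (deg j) := Submodule.sum_mem _ fun i _ => by
    split_ifs with h
    · exact Submodule.smul_mem _ _ (h ▸ hf i)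
    · rw [zero_smul]; exact zero_mem _
  have hq0 : q = 0 := eq_zero_of_mem_primDeg hq fun p hp => by
    have h0 := congrArg (fun x => pairing K N X x (treeBasis K N X o)) (hsum p hp)
    simp only [map_sum, map_smul, LinearMap.sum_apply, LinearMap.smul_apply, map_zero,
      LinearMap.zero_apply, smul_eq_mul] at h0
    simp only [q, map_sum, map_smul, LinearMap.sum_apply, LinearMap.smul_apply, smul_eq_mul]
    refine Eq.trans (Finset.sum_congr rfl fun i _ => ?_) h0
    split_ifs with h
    · exact mul_comm _ _
    · rw [pairing_homogeneous h (hf i).2 hp.2, mul_zero, zero_mul]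
  have := Fintype.linearIndependent_iff.1 (hlin.comp ((↑) : t → ι) Subtype.val_injective) _ hq0 j
  rwa [if_pos rfl] at this

end derivation

end FreeMag

end

/-! ### Generation by primitives and bases of monomials -/

noncomputable section

universe v

/-- The sum of an independent family of subspaces has a basis of elements of these subspaces. -/
lemma iSupIndep.exists_basis {K : Type*} {V : Type v} {ι : Type} [Field K] [AddCommGroup V]
    [Module K V] {A : ι → Submodule K V} (h : iSupIndep A) :
    ∃ (κ : Type v) (deg : κ → ι) (b : Module.Basis κ K ↥(⨆ i, A i)), ∀ i, (b i : V) ∈ A (deg i) := by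
  classical
  rw [← iSup_univ]
  have hint := DirectSum.isInternal_biSup_submodule_of_iSupIndep (A := A) Set.univ
    (h.comp Subtype.val_injective)
  let c := hint.collectedBasis fun k => Module.Basis.ofVectorSpace K _
  exact ⟨_, fun i => i.fst.val, c, fun i => Submodule.mem_comap.1 (hint.collectedBasis_mem _ i)⟩

namespace FreeMag

section generation

variable {K : Type*} [Field K] {N : ℕ∞} {X : Type*} {ι : Type*}

/-! ### Monomials in homogeneous primitive elements -/

/-- The span of the monomials of weighted degree `n` in the family `f` with weights `deg`. -/
def monomialSpan (f : ι → FreeMag K N X) (deg : ι → ℕ) (n : ℕ) : Submodule K (FreeMag K N X) :=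
  Submodule.span K {a | ∃ s : Multiset ι, (s.map deg).sum = n ∧ (s.map f).prod = a}

variable {f : ι → FreeMag K N X} {deg : ι → ℕ}

lemma mul_mem_monomialSpan {i j : ℕ} {a b : FreeMag K N X} (ha : a ∈ monomialSpan f deg i)
    (hb : b ∈ monomialSpan f deg j) : a * b ∈ monomialSpan f deg (i + j) := by
  have := Submodule.mul_mem_mul ha hb
  rw [monomialSpan, monomialSpan, Submodule.span_mul_span] at this
  refine Submodule.span_mono ?_ this
  rintro _ ⟨_, ⟨s, rfl, rfl⟩, _, ⟨t, rfl, rfl⟩, rfl⟩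
  exact ⟨s + t, by simp, by simp⟩

lemma prod_map_mem_homogeneous (hf : ∀ i, f i ∈ homogeneous K N X (deg i)) (s : Multiset ι) :
    (s.map f).prod ∈ homogeneous K N X (s.map deg).sum := by
  induction s using Multiset.induction_on with
  | empty => simpa using one_mem_homogeneous
  | cons i s ih => simpa using mul_mem_homogeneous (hf i) ih

lemma decomposable_le_monomialSpan {n : ℕ}
    (h : ∀ k < n, homogeneous K N X k ≤ monomialSpan f deg k) :
    decomposable K N X n ≤ monomialSpan f deg n := by
  refine Submodule.span_le.2 ?_
  rintro _ ⟨i, j, hi, hj, rfl, a, ha, b, hb, rfl⟩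
  exact mul_mem_monomialSpan (h i (by omega) ha) (h j (by omega) hb)

/-- Projecting a linear expression in the `f i` onto degree `n` leaves only the `f i` of degree `n`,
which are monomials with one factor. -/
lemma primDeg_le_monomialSpan (hf : ∀ i, f i ∈ homogeneous K N X (deg i)) {n : ℕ}
    (h : primDeg K N X n ≤ Submodule.span K (Set.range f)) :
    primDeg K N X n ≤ monomialSpan f deg n := by
  intro p hp
  have hle : Submodule.span K (Set.range f) ≤
      (monomialSpan f deg n).comap (homogeneousComponent K N X n) := by
    refine Submodule.span_le.2 ?_
    rintro _ ⟨i, rfl⟩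
    rw [SetLike.mem_coe, Submodule.mem_comap, homogeneousComponent_of_mem (hf i)]
    split_ifs with hi
    · exact Submodule.subset_span ⟨{i}, by simpa using hi, by simp⟩
    · exact zero_mem _
  have := hle (h hp)
  rwa [Submodule.mem_comap, homogeneousComponent_of_mem hp.2, if_pos rfl] at this

/-- Homogeneous elements are polynomials in homogeneous spanning families of primitive
elements. -/
lemma homogeneous_le_monomialSpan [CharZero K] (hf : ∀ i, f i ∈ homogeneous K N X (deg i)) {n : ℕ}
    (h : ∀ k, 0 < k → k ≤ n → primDeg K N X k ≤ Submodule.span K (Set.range f)) :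
    homogeneous K N X n ≤ monomialSpan f deg n := by
  induction n using Nat.strong_induction_on with
  | _ n ih =>
    rcases n.eq_zero_or_pos with rfl | hn
    · refine Submodule.span_le.2 ?_
      rintro _ ⟨_ | T, hT, rfl⟩
      · exact Submodule.subset_span ⟨0, by simp, by simp; rfl⟩
      · exact absurd hT T.degree_pos.ne'
    · rw [← primDeg_sup_decomposable hn]
      exact sup_le (primDeg_le_monomialSpan hf (h n hn le_rfl))
        (decomposable_le_monomialSpan fun k hk =>
          ih k hk fun m hm hmk => h m hm (hmk.trans hk.le))

/-- One factor of degree strictly below `n` leaves a remainder of positive degree, so splitting it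
off exhibits the monomial as a decomposable. -/
lemma monomialSpan_le_decomposable {n : ℕ} (hn : 0 < n)
    (hf : ∀ i, f i ∈ homogeneous K N X (deg i)) (h0 : ∀ i, 0 < deg i) (hlt : ∀ i, deg i < n) :
    monomialSpan f deg n ≤ decomposable K N X n := by
  refine Submodule.span_le.2 ?_
  rintro _ ⟨s, rfl, rfl⟩
  induction s using Multiset.induction_on with
  | empty => simp at hn
  | cons i s _ =>
    have := hlt i
    rw [Multiset.map_cons, Multiset.sum_cons] at this
    rw [Multiset.map_cons, Multiset.sum_cons, Multiset.map_cons, Multiset.prod_cons]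
    exact Submodule.subset_span ⟨_, _, h0 i, by omega, rfl, _, hf i, _,
      prod_map_mem_homogeneous hf s, rfl⟩

/-- The shuffle algebra is the symmetric algebra of a space of primitive elements with a
homogeneous basis, provided it contains all homogeneous primitive elements. -/
lemma isSymmetricAlgebra_of_basis [CharZero K] (hN : 2 ≤ N) {W : Submodule K (FreeMag K N X)}
    (b : Module.Basis ι K W) (hb : ∀ i, (b i : FreeMag K N X) ∈ primDeg K N X (deg i))
    (hW : ∀ k, primDeg K N X k ≤ W) : IsSymmetricAlgebra W.subtype := by
  let f : ι → FreeMag K N X := fun i => b i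
  have hlin : LinearIndependent K f := b.linearIndependent.map' W.subtype W.ker_subtype
  have hspan : Submodule.span K (Set.range f) = W := by
    have : Set.range f = W.subtype '' Set.range b := by
      rw [← Set.range_comp]; rfl
    rw [this, Submodule.span_image, b.span_eq, Submodule.map_top, Submodule.range_subtype]
  have hinj := algebraicIndependent_of_linearIndependent hN hb hlin
  have hsurj : Function.Surjective (MvPolynomial.aeval (R := K) f) := by
    have hle : ∀ n, homogeneous K N X n ≤
        LinearMap.range (MvPolynomial.aeval (R := K) f).toLinearMap := fun n => by
      refine (homogeneous_le_monomialSpan (f := f) (fun i => (hb i).2)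
        fun k _ _ => hspan.symm ▸ hW k).trans (Submodule.span_le.2 ?_)
      rintro _ ⟨s, -, rfl⟩
      refine ⟨(s.map MvPolynomial.X).prod, ?_⟩
      simp [map_multiset_prod]
    intro a
    obtain ⟨s, hs⟩ := exists_sum_homogeneousComponent a
    rw [hs]
    exact Submodule.sum_mem (LinearMap.range (MvPolynomial.aeval (R := K) f).toLinearMap)
      fun n _ => hle n (homogeneousComponent_mem n a)
  -- In the coordinates given by `b`, the canonical map from the symmetric algebra is evaluation of
  -- polynomials at `f`, already known to be bijective.
  have heq : SymmetricAlgebra.lift W.subtype = (MvPolynomial.aeval (R := K) f).comp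
      (SymmetricAlgebra.equivMvPolynomial b).toAlgHom := by
    refine SymmetricAlgebra.algHom_ext (b.ext fun i => ?_)
    simp [f]
  rw [IsSymmetricAlgebra, heq]
  exact (show Function.Bijective (MvPolynomial.aeval (R := K) f) from ⟨hinj, hsurj⟩).comp
    (SymmetricAlgebra.equivMvPolynomial b).bijective

lemma isSymmetricAlgebra_prim [CharZero K] (hN : 2 ≤ N) :
    IsSymmetricAlgebra (prim K N X).subtype := by
  obtain ⟨κ, deg, b, hb⟩ := (iSupIndep_primDeg (K := K) (N := N) (X := X)).exists_basis
  rw [← iSup_primDeg]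
  exact isSymmetricAlgebra_of_basis hN b hb (le_iSup _)

lemma prod_map_X [DecidableEq ι] (s : Multiset ι) :
    (s.map (MvPolynomial.X (R := K))).prod = MvPolynomial.monomial (Multiset.toFinsupp s) 1 := by
  induction s using Multiset.induction_on with
  | empty => simp
  | cons i s ih =>
    rw [Multiset.map_cons, Multiset.prod_cons, ih, ← Multiset.singleton_add, map_add,
      Multiset.toFinsupp_singleton, MvPolynomial.X, MvPolynomial.monomial_mul, one_mul]

/-- Sorted lists inject into exponent vectors, and an injective evaluation map keeps distinct
monomials linearly independent. -/
lemma linearIndependent_sorted_prod [LinearOrder ι] (hf : AlgebraicIndependent K f)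
    (p : List ι → Prop) (hp : ∀ l, p l → l.Pairwise (· ≤ ·)) :
    LinearIndependent K fun l : {l : List ι // p l} => (l.1.map f).prod := by
  have h := ((MvPolynomial.basisMonomials ι K).linearIndependent.map'
    (MvPolynomial.aeval (R := K) f).toLinearMap (LinearMap.ker_eq_bot.2 hf)).comp
    (fun l : {l : List ι // p l} => Multiset.toFinsupp (l.1 : Multiset ι)) fun l l' hll => by
      have := Multiset.coe_eq_coe.1 (Multiset.toFinsupp.injective hll)
      exact Subtype.ext (this.eq_of_pairwise' (hp _ l.2) (hp _ l'.2))
  have heq : (fun l : {l : List ι // p l} => (l.1.map f).prod) =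
      ((MvPolynomial.aeval (R := K) f).toLinearMap ∘ MvPolynomial.basisMonomials ι K) ∘
        fun l => Multiset.toFinsupp (l.1 : Multiset ι) := funext fun l => by
    simp [← prod_map_X, map_list_prod, Function.comp_def]
  rw [heq]
  exact h

lemma span_sorted_prod [LinearOrder ι] (n : ℕ) :
    Submodule.span K (Set.range fun l : {l : List ι // l.Pairwise (· ≤ ·) ∧ (l.map deg).sum = n} =>
      (l.1.map f).prod) = monomialSpan f deg n := by
  refine congrArg _ (Set.ext fun a => ⟨?_, ?_⟩)
  · rintro ⟨⟨l, hl, hn⟩, rfl⟩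
    exact ⟨l, by simpa using hn, by simp⟩
  · rintro ⟨s, hn, rfl⟩
    refine ⟨⟨s.sort (· ≤ ·), s.pairwise_sort _, ?_⟩, ?_⟩
    · rw [← hn, ← Multiset.sum_coe, ← Multiset.map_coe, Multiset.sort_eq]
    · dsimp only
      rw [← Multiset.prod_coe, ← Multiset.map_coe, Multiset.sort_eq]

end generation

end FreeMag

end

/-! ### The grading of `W`, freeness, and the monomial bases together -/

theorem theorem5p4 (K : Type*) [Field K] [CharZero K] (N : ℕ∞) (hN : 2 ≤ N) (X : Type*) :
    -- `W = Prim A` is graded by the subspaces `Prim A^{(k)}`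
    (iSupIndep (fun k : ℕ => FreeMag.primDeg K N X k) ∧
      ⨆ k : ℕ, FreeMag.primDeg K N X k = FreeMag.prim K N X) ∧
    -- (i) the commutative algebra `(A, ⧢)` is freely generated by `W`
    IsSymmetricAlgebra (FreeMag.prim K N X).subtype ∧
    -- (ii) bases of the orthogonal complement of `Prim A^{(n)}` in `A^{(n)}`
    ∀ (n : ℕ), 2 ≤ n → ∀ (ι : Type*) [LinearOrder ι] (f : ι → FreeMag K N X) (deg : ι → ℕ),
      (∀ i, f i ∈ FreeMag.homogeneous K N X (deg i)) →
      LinearIndependent K f →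
      Submodule.span K (Set.range f) = ⨆ k ∈ Finset.Ico 1 n, FreeMag.primDeg K N X k →
      LinearIndependent K
        (fun l : {l : List ι // l.Pairwise (· ≤ ·) ∧ (l.map deg).sum = n} => (l.1.map f).prod) ∧
      Submodule.span K (Set.range
        (fun l : {l : List ι // l.Pairwise (· ≤ ·) ∧ (l.map deg).sum = n} => (l.1.map f).prod)) =
          FreeMag.primPerp K N X n := by
  open FreeMag in
  refine ⟨⟨iSupIndep_primDeg, iSup_primDeg⟩, isSymmetricAlgebra_prim hN,
    fun n hn ι _ f deg hf hlin hspan => ?_⟩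
  have hmem : ∀ i, f i ∈ ⨆ k ∈ Finset.Ico 1 n, primDeg K N X k := fun i =>
    hspan ▸ Submodule.subset_span ⟨i, rfl⟩
  have hprim : ∀ i, f i ∈ primDeg K N X (deg i) := fun i =>
    ⟨(iSup₂_le fun _ _ => inf_le_left : ⨆ k ∈ Finset.Ico 1 n, primDeg K N X k ≤ prim K N X)
      (hmem i), hf i⟩
  have hpos : ∀ i, 0 < deg i := fun i => Nat.pos_of_ne_zero fun h0 => by
    have h1 := hprim i
    rw [h0, primDeg_zero, Submodule.mem_bot] at h1
    exact hlin.ne_zero i h1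
  -- The projection onto a degree at least `n` annihilates the sum of the lower primitive spaces but
  -- would fix `f i`, which is non-zero.
  have hlt : ∀ i, deg i < n := fun i => by
    by_contra hni
    have hle : ⨆ k ∈ Finset.Ico 1 n, primDeg K N X k ≤
        LinearMap.ker (homogeneousComponent K N X (deg i)) := iSup₂_le fun k hk p hp => by
      have := (Finset.mem_Ico.1 hk).2
      rw [LinearMap.mem_ker, homogeneousComponent_of_mem hp.2, if_neg (by omega)]
    have h0 := hle (hmem i)
    rw [LinearMap.mem_ker, homogeneousComponent_of_mem (hf i), if_pos rfl] at h0
    exact hlin.ne_zero i h0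
  refine ⟨linearIndependent_sorted_prod (algebraicIndependent_of_linearIndependent hN hprim hlin)
    _ fun l hl => hl.1, ?_⟩
  rw [span_sorted_prod, primPerp_eq_decomposable (by omega)]
  -- Degrees in `[1, n)` put every monomial of degree `n` among the decomposables. Conversely, the
  -- factors of a decomposable have degree below `n`, where the given primitives already generate.
  refine le_antisymm (monomialSpan_le_decomposable (by omega) hf hpos hlt)
    (decomposable_le_monomialSpan fun k hk => homogeneous_le_monomialSpan hf fun m hm hmk => ?_)
  rw [hspan]
  exact le_iSup₂ (f := fun k (_ : k ∈ Finset.Ico 1 n) => primDeg K N X k) m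
    (Finset.mem_Ico.2 ⟨hm, by omega⟩)
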